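/- **Theorem.** A *set of directions* is a set $\mathcal D$ of unit vectors in the plane such that $v\in\mathcal D$ implies $-v\in\mathcal D$. A *$\mathcal D$-pair* is a pair $(v_1,v_2)$ of distinct vectors of $\mathcal D$ such that no vector of $\mathcal D$ lies strictly between them when going counterclockwise from $v_1$ to $v_2$; let $\alpha(v_1,v_2)$ be the counterclockwise angle from $v_1$ to $v_2$. The *density* $\alpha(\mathcal D)$ is the largest $\alpha(v_1,v_2)$ over all $\mathcal D$-pairs (and $0$ if there are none, as for the set of all directions). Let $\mathcal Q(\mathcal D)$ consist of the two open half-planes bounded by the line $\mathbb R v$, for every $v\in\mathcal D$, and of the two open quadrants $\{-a v_1+b v_2: a,b>0\}$ and $\{a v_1-b v_2: a,b>0\}$, for every $\mathcal D$-pair $(v_1,v_2)$. For $S\subseteq\mathbb R^2$, the *$\mathcal D$-convex hull* $\mathcal{DCH}_{\mathcal D}(S)$ is the plane minus the union of all translates of members of $\mathcal Q(\mathcal D)$ that contain no point of $S$. A *vertex* of this closed set is a point of its boundary in no neighbourhood of which the boundary coincides with a straight line. There is an absolute constant $K>0$ such that, for every set of directions $\mathcal D$ with $\alpha(\mathcal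 D)\le \pi/2$ and every $n$, if $N$ is a set of $n$ points chosen uniformly and independently from the unit disk, then the expected number of vertices of $\mathcal{DCH}_{\mathcal D}(N)$ is at most $$K\left(n^{1/3}+\sqrt{n\,\alpha(\mathcal D)}\right).$$ -/

import Mathlib

open MeasureTheory ProbabilityTheory
open scoped ENNReal

noncomputable section

namespace DirHull

/-- A set of directions: unit vectors of the plane `ℂ`, closed under negation. -/
def IsDirectionSet (D : Set ℂ) : Prop :=
  ∀ v ∈ D, ‖v‖ = 1 ∧ -v ∈ D

/-- The counterclockwise angle from `v` to `w`, in `[0, 2π)`. -/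
def ccwAngle (v w : ℂ) : ℝ :=
  toIcoMod Real.two_pi_pos 0 (Complex.arg (w / v))

/-- `v₁, v₂` are consecutive in `D`: going counterclockwise from `v₁` to `v₂ ≠ v₁`, no vector of
`D` is met strictly in between. -/
def IsDPair (D : Set ℂ) (v₁ v₂ : ℂ) : Prop :=
  v₁ ∈ D ∧ v₂ ∈ D ∧ v₁ ≠ v₂ ∧
    ∀ w ∈ D, ¬ (0 < ccwAngle v₁ w ∧ ccwAngle v₁ w < ccwAngle v₁ v₂)

/-- The density of `D`: the largest counterclockwise angle of a pair of consecutive vectors. It is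
`0` if there is no such pair, for instance if `D` is the set of all directions. -/
def density (D : Set ℂ) : ℝ :=
  sSup {θ : ℝ | ∃ v₁ v₂ : ℂ, IsDPair D v₁ v₂ ∧ θ = ccwAngle v₁ v₂}

/-- The set of all positive linear combinations of `u₁` and `u₂`. -/
def pspan (u₁ u₂ : ℂ) : Set ℂ :=
  {z : ℂ | ∃ a b : ℝ, 0 < a ∧ 0 < b ∧ z = (a : ℂ) * u₁ + (b : ℂ) * u₂}

/-- The open half-plane to the left of the line through `0` with direction `v`. -/
def leftHalfPlane (v : ℂ) : Set ℂ :=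
  {z : ℂ | 0 < (starRingEnd ℂ v * z).im}

/-- The open half-plane to the right of the line through `0` with direction `v`. -/
def rightHalfPlane (v : ℂ) : Set ℂ :=
  {z : ℂ | (starRingEnd ℂ v * z).im < 0}

/-- The family of half-planes and quadrants induced by `D`. -/
def ranges (D : Set ℂ) : Set (Set ℂ) :=
  {Q | ∃ v ∈ D, Q = leftHalfPlane v ∨ Q = rightHalfPlane v} ∪
    {Q | ∃ v₁ v₂ : ℂ, IsDPair D v₁ v₂ ∧ (Q = pspan v₁ (-v₂) ∨ Q = pspan (-v₁) v₂)}

/-- All translates of the half-planes and quadrants induced by `D`. -/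
def translates (D : Set ℂ) : Set (Set ℂ) :=
  {I | ∃ Q ∈ ranges D, ∃ p : ℂ, I = (fun z : ℂ => z + p) '' Q}

/-- The `D`-convex hull of `S`: what remains of the plane after removing every translate of an
induced half-plane or quadrant that contains no point of `S`. -/
def hull (D S : Set ℂ) : Set ℂ :=
  Set.univ \ ⋃ I ∈ {I | I ∈ translates D ∧ I ∩ S = ∅}, I

/-- The vertices of a closed polygonal set `C`: the points of the topological boundary of `C` near
which this boundary is not a straight line. The points that are not vertices are thus those in the
relative interior of an edge (an edge may bound `C` on one side, or be a one-dimensional part of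
`C`); corners of either convexity, end points and isolated points of `C` are vertices. -/
def vertices (C : Set ℂ) : Set ℂ :=
  {x ∈ frontier C | ¬ ∃ u : ℂ, u ≠ 0 ∧ ∃ ε : ℝ, 0 < ε ∧
    frontier C ∩ Metric.ball x ε = {z : ℂ | ∃ t : ℝ, z = x + (t : ℂ) * u} ∩ Metric.ball x ε}

/-- The law of `n` points chosen uniformly and independently from the closed unit disk. -/
def uniformSample (n : ℕ) : Measure (Fin n → ℂ) :=
  Measure.pi fun _ : Fin n => (volume : Measure ℂ)[|Metric.closedBall (0 : ℂ) 1]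

/-- The (upper) expectation of a nonnegative extended-real quantity. For a measurable quantity this
is its expectation, see `expectation_eq_lintegral`; in general it is the least expectation of a
measurable quantity that dominates it almost surely. -/
def expectation {Ω : Type*} [MeasurableSpace Ω] (μ : Measure Ω) (f : Ω → ℝ≥0∞) : ℝ≥0∞ :=
  ⨅ (g : Ω → ℝ≥0∞) (_ : Measurable g) (_ : ∀ᵐ ω ∂μ, f ω ≤ g ω), ∫⁻ ω, g ω ∂μ

theorem lintegral_le_expectation {Ω : Type*} [MeasurableSpace Ω] (μ : Measure Ω)
    (f : Ω → ℝ≥0∞) : ∫⁻ ω, f ω ∂μ ≤ expectation μ f :=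
  le_iInf fun _ => le_iInf fun _ => le_iInf fun h => lintegral_mono_ae h

theorem expectation_eq_lintegral {Ω : Type*} [MeasurableSpace Ω] (μ : Measure Ω)
    {f : Ω → ℝ≥0∞} (hf : AEMeasurable f μ) : expectation μ f = ∫⁻ ω, f ω ∂μ := by
  refine le_antisymm ?_ (lintegral_le_expectation μ f)
  rw [lintegral_congr_ae hf.ae_eq_mk]
  exact iInf_le_of_le (hf.mk f) (iInf_le_of_le hf.measurable_mk
    (iInf_le _ (hf.ae_eq_mk.mono fun _ h => h.le)))

instance uniformSample_isProbabilityMeasure (n : ℕ) : IsProbabilityMeasure (uniformSample n) := by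
  have : IsProbabilityMeasure ((volume : Measure ℂ)[|Metric.closedBall (0 : ℂ) 1]) :=
    cond_isProbabilityMeasure_of_finite
      (Metric.measure_closedBall_pos volume (0 : ℂ) one_pos).ne'
      (measure_closedBall_lt_top (μ := volume) (x := (0 : ℂ))).ne
  unfold uniformSample
  infer_instance

end DirHull

end

/-!
The bound is the product of a deterministic count and a probability estimate.

*Deterministic part.* Every induced half-plane or quadrant is a wedge `L(v₁) ∩ L(v₂)`, where `L(v)`
is the half-plane to the left of `v` and `v₁ = v₂ ∈ D` or `(v₁, v₂)` is a pair of consecutive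
vectors of `D`. For a finite set `S` the hull does not change if the set of these pairs is replaced
by its closure (`hull_eq_hullOf`), and the closure is a compact family of pairs with a few formal
properties (`IsGapFamily`). The decisive one is that no direction of the family lies strictly inside
a gap. It makes the hull convex in each direction of the family (`mem_hullOf_of_between`).
A point `p ∈ S` is exposed if it is the apex of a wedge without points of `S`. By compactness each
boundary point of the hull is the apex of such a wedge, so a vertex in `S` is exposed. A vertex `x`
outside `S` is an end of the intersection of the hull with a line through a point `p ∈ S`, or the
apex of an empty wedge with points of `S` on both sides (`end_or_corner_of_vertex`). In both cases
`x` is charged to such a point `p`, which is exposed. For a fixed `p` all charges of one kind come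
from a single line, as otherwise one of the charged vertices would lie in the empty wedge of another
(`fst_eq_or_eq_neg`, `snd_eq_or_eq_neg`), and on each of the two rays of this line from `p` there is
only one of them. So there are at most seven vertices for each exposed point
(`encard_vertices_le`).

*Probability part.* Let `p` be at distance `h` from the unit circle and let `α` be the density. The
box centred at `p` with radial side `h` and tangential side `h / s`, `s = min 1 (max √h α)`, lies in
the disk. After rescaling the box to a square, each wedge with apex `p` still has an angle of at
least `π / 2`, hence contains one of the eight triangles cut out by the axes and the diagonals
(`exists_sector_subset_wedge`). So if `p` is exposed, then one of eight regions of area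
proportional to `h² / s` is empty, which for `m` further points has probability at most
`8 exp (-b h² / s)` with `b` proportional to `m`. Integrating over the disk gives a bound of order
`m ^ (-2 / 3) + √(α / m)` (`uniformSample_emptySector_le_ofReal`), and summing over the points
yields the theorem.
-/

/-! ### The cross product and the dot product of the plane -/

namespace DirHull

open Filter Topology

/-- The cross product of two vectors of the plane. -/
def cr (v w : ℂ) : ℝ := v.re * w.im - v.im * w.re

/-- The dot product of two vectors of the plane. -/
def dt (v w : ℂ) : ℝ := v.re * w.re + v.im * w.im

lemma cr_add_right (v w z : ℂ) : cr v (w + z) = cr v w + cr v z := by simp [cr]; ring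
lemma cr_sub_right (v w z : ℂ) : cr v (w - z) = cr v w - cr v z := by simp [cr]; ring
lemma cr_neg_right (v w : ℂ) : cr v (-w) = -cr v w := by simp [cr]; ring
lemma cr_neg_left (v w : ℂ) : cr (-v) w = -cr v w := by simp [cr]; ring
lemma cr_mul_right (v : ℂ) (t : ℝ) (w : ℂ) : cr v (t * w) = t * cr v w := by simp [cr]; ring
lemma cr_self (v : ℂ) : cr v v = 0 := by simp [cr]; ring
lemma cr_comm (v w : ℂ) : cr v w = -cr w v := by simp [cr]; ring
lemma dt_comm (v w : ℂ) : dt v w = dt w v := by simp [dt]; ring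
lemma dt_neg_right (v w : ℂ) : dt v (-w) = -dt v w := by simp [dt]; ring

lemma dt_self {v : ℂ} (hv : ‖v‖ = 1) : dt v v = 1 := by
  have h := Complex.sq_norm v
  rw [hv, Complex.normSq_apply] at h
  simp only [dt]; linarith

lemma cr_sq_add_dt_sq {v w : ℂ} (hv : ‖v‖ = 1) (hw : ‖w‖ = 1) : cr v w ^ 2 + dt v w ^ 2 = 1 := by
  have h1 := dt_self hv
  have h2 := dt_self hw
  have : cr v w ^ 2 + dt v w ^ 2 = dt v v * dt w w := by simp only [cr, dt]; ring
  rw [this, h1, h2, one_mul]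

lemma cr_sq_add_dt_sq_eq_norm_sq {v : ℂ} (hv : ‖v‖ = 1) (w : ℂ) :
    cr v w ^ 2 + dt v w ^ 2 = ‖w‖ ^ 2 := by
  have h1 := dt_self hv
  have : cr v w ^ 2 + dt v w ^ 2 = dt v v * dt w w := by simp only [cr, dt]; ring
  rw [this, h1, one_mul, Complex.sq_norm, Complex.normSq_apply, dt]

lemma abs_cr_le {v : ℂ} (hv : ‖v‖ = 1) (w : ℂ) : |cr v w| ≤ ‖w‖ :=
  abs_le_of_sq_le_sq (by nlinarith [cr_sq_add_dt_sq_eq_norm_sq hv w, sq_nonneg (dt v w)])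
    (norm_nonneg _)

/-- Expansion of a cross product in the orthonormal frame of a unit vector `v`. -/
lemma cr_eq_of_unit {v : ℂ} (hv : ‖v‖ = 1) (a e : ℂ) :
    cr a e = dt v e * cr a v + cr v e * dt a v := by
  have h1 := dt_self hv
  have : dt v v * cr a e = dt v e * cr a v + cr v e * dt a v := by simp only [cr, dt]; ring
  rwa [h1, one_mul] at this

lemma eq_mul_of_cr_eq_zero {v z : ℂ} (hv : ‖v‖ = 1) (h : cr v z = 0) : z = (dt v z : ℝ) * v := by
  have h1 := dt_self hv
  simp only [cr, dt] at h h1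
  apply Complex.ext
  · simp [dt]; linear_combination (-z.re) * h1 - v.im * h
  · simp [dt]; linear_combination (-z.im) * h1 + v.re * h

lemma eq_or_eq_neg_of_cr_eq_zero {v w : ℂ} (hv : ‖v‖ = 1) (hw : ‖w‖ = 1) (h : cr v w = 0) :
    w = v ∨ w = -v := by
  have h1 := cr_sq_add_dt_sq hv hw
  have h2 := eq_mul_of_cr_eq_zero hv h
  rw [h] at h1
  have h3 : (dt v w - 1) * (dt v w + 1) = 0 := by linarith
  rcases mul_eq_zero.1 h3 with h | h
  · left; rw [h2, show dt v w = 1 by linarith]; simp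
  · right; rw [h2, show dt v w = -1 by linarith]; simp

lemma eq_of_cr_eq_zero {v w : ℂ} (hv : ‖v‖ = 1) (hw : ‖w‖ = 1) (h : cr v w = 0)
    (hd : 0 ≤ dt v w) : w = v := by
  rcases eq_or_eq_neg_of_cr_eq_zero hv hw h with h | h
  · exact h
  · rw [h, dt_neg_right, dt_self hv] at hd
    norm_num at hd

lemma continuous_cr : Continuous fun p : ℂ × ℂ => cr p.1 p.2 := by unfold cr; fun_prop

lemma continuous_dt : Continuous fun p : ℂ × ℂ => dt p.1 p.2 := by unfold dt; fun_prop

lemma _root_.Continuous.cr {X : Type*} [TopologicalSpace X] {f g : X → ℂ} (hf : Continuous f)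
    (hg : Continuous g) : Continuous fun x => cr (f x) (g x) :=
  continuous_cr.comp (hf.prodMk hg)

lemma _root_.Continuous.dt {X : Type*} [TopologicalSpace X] {f g : X → ℂ} (hf : Continuous f)
    (hg : Continuous g) : Continuous fun x => dt (f x) (g x) :=
  continuous_dt.comp (hf.prodMk hg)

/-! ### Families of wedges and their hulls -/

/-- The open wedge of the points to the left of both lines through `0` with directions `f.1` and
`f.2`. It is a half-plane if `f.1 = f.2`. -/
def wedge (f : ℂ × ℂ) : Set ℂ := {z | 0 < cr f.1 z ∧ 0 < cr f.2 z}

/-- What the hull depends on: a closed set of pairs of unit vectors at angle at most `π / 2`,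
containing the pair `(v, v)` for each `v` that occurs in it, symmetric, and such that no vector
that occurs lies strictly between the two vectors of a pair. -/
structure IsGapFamily (F : Set (ℂ × ℂ)) : Prop where
  closed : IsClosed F
  norm_fst : ∀ f ∈ F, ‖f.1‖ = 1
  norm_snd : ∀ f ∈ F, ‖f.2‖ = 1
  cr_nonneg : ∀ f ∈ F, 0 ≤ cr f.1 f.2
  dt_nonneg : ∀ f ∈ F, 0 ≤ dt f.1 f.2
  diag_fst : ∀ f ∈ F, (f.1, f.1) ∈ F
  diag_snd : ∀ f ∈ F, (f.2, f.2) ∈ F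
  neg_mem : ∀ f ∈ F, -f ∈ F
  gap : ∀ f ∈ F, ∀ w, (w, w) ∈ F → ¬ (0 < cr f.1 w ∧ 0 < cr w f.2)

/-- The wedge of `f` with apex `x` contains no point of `S`. -/
def Free (S : Set ℂ) (f : ℂ × ℂ) (x : ℂ) : Prop := ∀ s ∈ S, s - x ∉ wedge f

/-- The plane minus all translates of wedges of `F` that contain no point of `S`. -/
def hullOf (F : Set (ℂ × ℂ)) (S : Set ℂ) : Set ℂ :=
  {x | ∀ f ∈ F, ∀ c, Free S f c → x - c ∉ wedge f}

variable {F : Set (ℂ × ℂ)} {S : Set ℂ}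

lemma subset_hullOf : S ⊆ hullOf F S := fun s hs _ _ _ hc => hc s hs

lemma isOpen_wedge_prod : IsOpen {p : (ℂ × ℂ) × ℂ | p.2 ∈ wedge p.1} := by
  have h1 : Continuous fun p : (ℂ × ℂ) × ℂ => cr p.1.1 p.2 := by
    apply Continuous.cr <;> fun_prop
  have h2 : Continuous fun p : (ℂ × ℂ) × ℂ => cr p.1.2 p.2 := by
    apply Continuous.cr <;> fun_prop
  exact (isOpen_lt continuous_const h1).inter (isOpen_lt continuous_const h2)

lemma isOpen_wedge (f : ℂ × ℂ) : IsOpen (wedge f) :=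
  isOpen_wedge_prod.preimage (Continuous.prodMk_right f)

lemma isClosed_hullOf : IsClosed (hullOf F S) := by
  have : hullOf F S = ⋂ f ∈ F, ⋂ c, ⋂ (_ : Free S f c), {x | x - c ∉ wedge f} := by
    ext x; simp [hullOf]
  rw [this]
  refine isClosed_biInter fun f _ => isClosed_iInter fun c => isClosed_iInter fun _ => ?_
  exact ((isOpen_wedge f).preimage (continuous_id.sub continuous_const)).isClosed_compl

lemma exists_free_of_notMem {z : ℂ} (hz : z ∉ hullOf F S) : ∃ f ∈ F, Free S f z := by
  simp only [hullOf, Set.mem_ofPred_eq, not_forall, not_not] at hz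
  obtain ⟨f, hf, c, hc, hz⟩ := hz
  refine ⟨f, hf, fun s hs h => hc s hs ?_⟩
  rw [show s - c = (s - z) + (z - c) by ring]
  exact ⟨by rw [cr_add_right]; exact add_pos h.1 hz.1, by rw [cr_add_right]; exact add_pos h.2 hz.2⟩

namespace IsGapFamily

lemma isCompact (hF : IsGapFamily F) : IsCompact F := by
  refine Metric.isCompact_of_isClosed_isBounded hF.closed ?_
  refine (Metric.isBounded_closedBall (x := (0 : ℂ × ℂ)) (r := 1)).subset fun f hf => ?_
  simp [Prod.norm_def, hF.norm_fst f hf, hF.norm_snd f hf]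

/-- A line whose direction occurs in `F` crosses every wedge of `F` in an unbounded set. -/
lemma cr_same_sign (hF : IsGapFamily F) {f : ℂ × ℂ} (hf : f ∈ F) {v : ℂ} (hv : (v, v) ∈ F) :
    (cr f.1 v ≤ 0 ∧ cr f.2 v ≤ 0) ∨ (0 ≤ cr f.1 v ∧ 0 ≤ cr f.2 v) := by
  have h1 := hF.gap f hf v hv
  have h2 := hF.gap f hf (-v) (hF.neg_mem _ hv)
  rw [cr_comm v] at h1
  rw [cr_neg_right, cr_neg_left, cr_comm v] at h2
  by_contra h
  push Not at h
  grind

/-- The hull is convex in every direction that occurs in `F`. -/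
lemma mem_hullOf_of_between (hF : IsGapFamily F) {v x : ℂ} (hv : (v, v) ∈ F) {t τ : ℝ}
    (ht : 0 ≤ t) (hτ : 0 ≤ τ) (hp : x - t * v ∈ hullOf F S) (hq : x + τ * v ∈ hullOf F S) :
    x ∈ hullOf F S := by
  intro f hf c hc hx
  rcases hF.cr_same_sign hf hv with h | h
  · refine hp f hf c hc ?_
    rw [show x - t * v - c = (x - c) - t * v by ring]
    simp only [wedge, Set.mem_ofPred_eq, cr_sub_right _ _ (t * v), cr_mul_right]
    exact ⟨by nlinarith [hx.1], by nlinarith [hx.2]⟩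
  · refine hq f hf c hc ?_
    rw [show x + τ * v - c = (x - c) + τ * v by ring]
    simp only [wedge, Set.mem_ofPred_eq, cr_add_right, cr_mul_right]
    exact ⟨by nlinarith [hx.1], by nlinarith [hx.2]⟩

/-- Points outside the hull that converge to `x` are apices of empty wedges, of which a subsequence
converges to an empty wedge with apex `x`. -/
lemma exists_free_limit (hF : IsGapFamily F) {A : Set ℂ} (hA : ∀ y ∈ A, y ∉ hullOf F S) {x : ℂ}
    (hx : x ∈ closure A) : ∃ (y : ℕ → ℂ) (f : ℕ → ℂ × ℂ) (g : ℂ × ℂ), g ∈ F ∧ Free S g x ∧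
      (∀ k, y k ∈ A) ∧ (∀ k, f k ∈ F) ∧ (∀ k, Free S (f k) (y k)) ∧
      Tendsto y atTop (𝓝 x) ∧ Tendsto f atTop (𝓝 g) := by
  obtain ⟨y, hyA, hy⟩ := mem_closure_iff_seq_limit.1 hx
  choose f hf hfree using fun k => exists_free_of_notMem (hA _ (hyA k))
  obtain ⟨g, hg, φ, hφ, hlim⟩ := hF.isCompact.tendsto_subseq hf
  have hy' := hy.comp hφ.tendsto_atTop
  refine ⟨y ∘ φ, f ∘ φ, g, hg, fun s hs h => ?_, fun k => hyA _, fun k => hf _,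
    fun k => hfree _, hy', hlim⟩
  have h1 : Tendsto (fun k => ((f ∘ φ) k, s - (y ∘ φ) k)) atTop (𝓝 (g, s - x)) :=
    hlim.prodMk_nhds (tendsto_const_nhds.sub hy')
  obtain ⟨k, hk⟩ := (h1.eventually (isOpen_wedge_prod.mem_nhds h)).exists
  exact hfree _ s hs hk

lemma exists_free_of_mem_frontier (hF : IsGapFamily F) {x : ℂ} (hx : x ∈ frontier (hullOf F S)) :
    ∃ f ∈ F, Free S f x := by
  rw [frontier_eq_closure_inter_closure] at hx
  obtain ⟨_, _, g, hg, h, _⟩ := hF.exists_free_limit (fun y hy => hy) hx.2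
  exact ⟨g, hg, h⟩

lemma eq_of_cr_eq_zero (hF : IsGapFamily F) {f : ℂ × ℂ} (hf : f ∈ F) (h : cr f.1 f.2 = 0) :
    f.2 = f.1 :=
  DirHull.eq_of_cr_eq_zero (hF.norm_fst f hf) (hF.norm_snd f hf) h (hF.dt_nonneg f hf)

/-- A pair of two different vectors is isolated in `F`. -/
lemma eventually_eq (hF : IsGapFamily F) {g : ℂ × ℂ} (hg : g ∈ F) (h : 0 < cr g.1 g.2) :
    ∀ᶠ f in 𝓝 g, f ∈ F → f = g := by
  have ev : ∀ u : ℂ × ℂ → ℝ, Continuous u → 0 < u g → ∀ᶠ f in 𝓝 g, 0 < u f := fun u hu h =>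
    hu.continuousAt.eventually (lt_mem_nhds h)
  have e1 := ev (fun f => cr f.1 g.2) (by apply Continuous.cr <;> fun_prop) h
  have e2 := ev (fun f => cr g.1 f.2) (by apply Continuous.cr <;> fun_prop) h
  have e3 := ev (fun f => dt g.1 f.1) (by apply Continuous.dt <;> fun_prop)
    (by simp [dt_self (hF.norm_fst g hg)])
  have e4 := ev (fun f => dt g.2 f.2) (by apply Continuous.dt <;> fun_prop)
    (by simp [dt_self (hF.norm_snd g hg)])
  filter_upwards [e1, e2, e3, e4] with f h1 h2 h3 h4 hf
  have g1 := hF.gap g hg f.1 (hF.diag_fst f hf)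
  have g2 := hF.gap f hf g.1 (hF.diag_fst g hg)
  have g3 := hF.gap g hg f.2 (hF.diag_snd f hf)
  have g4 := hF.gap f hf g.2 (hF.diag_snd g hg)
  have c1 := cr_comm f.1 g.1
  have c2 := cr_comm f.2 g.2
  refine Prod.ext (DirHull.eq_of_cr_eq_zero (hF.norm_fst g hg) (hF.norm_fst f hf) ?_ h3.le)
    (DirHull.eq_of_cr_eq_zero (hF.norm_snd g hg) (hF.norm_snd f hf) ?_ h4.le)
  · by_contra hne
    rcases lt_or_gt_of_ne hne with h | h
    · exact g2 ⟨by linarith, h2⟩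
    · exact g1 ⟨h, h1⟩
  · by_contra hne
    rcases lt_or_gt_of_ne hne with h | h
    · exact g3 ⟨h2, by linarith⟩
    · exact g4 ⟨h1, h⟩

end IsGapFamily

/-! ### Sliding an empty wedge -/

/-- If the apex of a wedge cannot be moved by any positive multiple of `-d` without losing
emptiness, then one and the same point of the finite set `S` prevents this. -/
lemma exists_mem_of_slide (hS : S.Finite) {f : ℂ × ℂ} {x d : ℂ} (h1 : 0 ≤ cr f.1 d)
    (h2 : 0 ≤ cr f.2 d) (h : ∀ ε : ℝ, 0 < ε → ¬ Free S f (x - ε * d)) :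
    ∃ s ∈ S, ∀ ε : ℝ, 0 < ε → 0 < cr f.1 (s - x) + ε * cr f.1 d ∧
      0 < cr f.2 (s - x) + ε * cr f.2 d := by
  by_contra! H
  have key : ∀ s ∈ S, ∀ᶠ ε : ℝ in 𝓝[>] 0, s - (x - ε * d) ∉ wedge f := by
    intro s hs
    obtain ⟨δ, hδ, h'⟩ := H s hs
    filter_upwards [Ioo_mem_nhdsGT hδ] with ε hε hw
    rw [show s - (x - ε * d) = (s - x) + ε * d by ring] at hw
    simp only [wedge, Set.mem_ofPred_eq, cr_add_right, cr_mul_right] at hw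
    have := h' (by nlinarith [hw.1, hε.1, hε.2])
    nlinarith [hw.2, hε.1, hε.2]
  obtain ⟨ε, hε, hpos⟩ := (((eventually_all_finite hS).2 key).and self_mem_nhdsWithin).exists
  exact h ε hpos hε

lemma nonneg_of_forall_pos {a b : ℝ} (h : ∀ ε : ℝ, 0 < ε → 0 < a + ε * b) : 0 ≤ a := by
  have h1 : Tendsto (fun ε : ℝ => a + ε * b) (𝓝[>] 0) (𝓝 (a + 0 * b)) :=
    (by fun_prop : Continuous fun ε : ℝ => a + ε * b).continuousAt.tendsto.mono_left
      nhdsWithin_le_nhds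
  have := ge_of_tendsto' (b := (0 : ℝ)) (h1.congr' ?_) (f := fun ε => max (a + ε * b) 0)
    (fun ε => le_max_right _ _)
  · simpa using this
  · filter_upwards [self_mem_nhdsWithin] with ε hε
    exact (max_eq_left (h ε hε).le).symm

namespace IsGapFamily

/-- If the apex of an empty wedge cannot be moved forward along its first side, then there is a
point of `S` on the second side. -/
lemma slide_fst (hF : IsGapFamily F) (hS : S.Finite) {f : ℂ × ℂ} (hf : f ∈ F)
    (hc : 0 < cr f.1 f.2) {x : ℂ} (hfree : Free S f x) :
    (∃ ε : ℝ, 0 < ε ∧ Free S f (x + ε * f.1)) ∨ ∃ σ : ℝ, 0 < σ ∧ x + σ * f.2 ∈ S := by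
  by_contra! H
  obtain ⟨s, hs, h⟩ := exists_mem_of_slide (f := f) (x := x) (d := -f.1) hS
    (by simp [cr_neg_right, cr_self]) (by rw [cr_neg_right, ← cr_comm]; exact hc.le)
    (by intro ε hε; simpa using H.1 ε hε)
  have h1 : 0 < cr f.1 (s - x) := by simpa [cr_neg_right, cr_self] using (h 1 one_pos).1
  have h2 : 0 ≤ cr f.2 (s - x) := nonneg_of_forall_pos fun ε hε => (h ε hε).2
  have h3 : cr f.2 (s - x) = 0 := le_antisymm (not_lt.1 fun h => hfree s hs ⟨h1, h⟩) h2
  have h4 := eq_mul_of_cr_eq_zero (hF.norm_snd f hf) h3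
  rw [h4, cr_mul_right] at h1
  refine H.2 (dt f.2 (s - x)) (pos_of_mul_pos_left h1 hc.le) ?_
  rwa [← h4, add_sub_cancel]

/-- The mirror image of `slide_fst`. -/
lemma slide_snd (hF : IsGapFamily F) (hS : S.Finite) {f : ℂ × ℂ} (hf : f ∈ F)
    (hc : 0 < cr f.1 f.2) {x : ℂ} (hfree : Free S f x) :
    (∃ ε : ℝ, 0 < ε ∧ Free S f (x - ε * f.2)) ∨ ∃ σ : ℝ, 0 < σ ∧ x - σ * f.1 ∈ S := by
  by_contra! H
  obtain ⟨s, hs, h⟩ := exists_mem_of_slide (f := f) (x := x) (d := f.2) hS hc.le (by simp [cr_self])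
    (by intro ε hε; simpa using H.1 ε hε)
  have h1 : 0 < cr f.2 (s - x) := by simpa [cr_self] using (h 1 one_pos).2
  have h2 : 0 ≤ cr f.1 (s - x) := nonneg_of_forall_pos fun ε hε => (h ε hε).1
  have h3 : cr f.1 (s - x) = 0 := le_antisymm (not_lt.1 fun h => hfree s hs ⟨h, h1⟩) h2
  have h4 := eq_mul_of_cr_eq_zero (hF.norm_fst f hf) h3
  rw [h4, cr_mul_right, cr_comm] at h1
  refine H.2 (-dt f.1 (s - x)) (by nlinarith) ?_
  rwa [Complex.ofReal_neg, neg_mul, ← h4, sub_neg_eq_add, add_sub_cancel]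

/-- If the apex of an empty wedge can be moved forward along its first side, then near the original
apex everything to the left of this side is outside the hull. -/
lemma removed_of_free_fst (hF : IsGapFamily F) {f : ℂ × ℂ} (hf : f ∈ F) (hc : 0 < cr f.1 f.2)
    {x : ℂ} {ε : ℝ} (hε : 0 < ε) (h : Free S f (x + ε * f.1)) :
    ∃ δ : ℝ, 0 < δ ∧ ∀ y, ‖y - x‖ < δ → 0 < cr f.1 (y - x) → y ∉ hullOf F S := by
  refine ⟨ε * cr f.1 f.2, mul_pos hε hc, fun y hy hpos hmem => hmem f hf _ h ?_⟩
  rw [show y - (x + ε * f.1) = (y - x) - ε * f.1 by ring]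
  simp only [wedge, Set.mem_ofPred_eq, cr_sub_right _ _ (ε * f.1), cr_mul_right, cr_self,
    cr_comm f.2 f.1]
  have := abs_le.1 (abs_cr_le (hF.norm_snd f hf) (y - x))
  exact ⟨by linarith, by linarith [this.1]⟩

/-- The mirror image of `removed_of_free_fst`. -/
lemma removed_of_free_snd (hF : IsGapFamily F) {f : ℂ × ℂ} (hf : f ∈ F) (hc : 0 < cr f.1 f.2)
    {x : ℂ} {ε : ℝ} (hε : 0 < ε) (h : Free S f (x - ε * f.2)) :
    ∃ δ : ℝ, 0 < δ ∧ ∀ y, ‖y - x‖ < δ → 0 < cr f.2 (y - x) → y ∉ hullOf F S := by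
  refine ⟨ε * cr f.1 f.2, mul_pos hε hc, fun y hy hpos hmem => hmem f hf _ h ?_⟩
  rw [show y - (x - ε * f.2) = (y - x) + ε * f.2 by ring]
  simp only [wedge, Set.mem_ofPred_eq, cr_add_right, cr_mul_right, cr_self]
  have := abs_le.1 (abs_cr_le (hF.norm_fst f hf) (y - x))
  exact ⟨by linarith [this.1], by linarith⟩

/-- Every point of the hull that is the apex of an empty wedge sees a point of `S` along one of the
two rays that bound the wedge. -/
lemma exists_mem_ray (hF : IsGapFamily F) (hS : S.Finite) {f : ℂ × ℂ} (hf : f ∈ F) {x : ℂ}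
    (hx : x ∈ hullOf F S) (hxS : x ∉ S) (hfree : Free S f x) :
    ∃ t : ℝ, 0 < t ∧ (x - t * f.1 ∈ S ∨ x + t * f.2 ∈ S) := by
  have hn1 := hF.norm_fst f hf
  have hn2 := hF.norm_snd f hf
  have hdt := hF.dt_nonneg f hf
  have hcr := hF.cr_nonneg f hf
  -- the vector `i (f.1 + f.2)` points into the wedge
  set d : ℂ := Complex.I * (f.1 + f.2) with hd
  have hd1 : cr f.1 d = 1 + dt f.1 f.2 := by
    rw [← dt_self hn1]; simp [hd, cr, dt]; ring
  have hd2 : cr f.2 d = 1 + dt f.1 f.2 := by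
    rw [← dt_self hn2]; simp [hd, cr, dt]; ring
  obtain ⟨s, hs, h⟩ := exists_mem_of_slide (x := x) (d := d) hS (by linarith) (by linarith) (by
    intro ε hε hfr
    refine hx f hf _ hfr ?_
    rw [sub_sub_cancel]
    simp only [wedge, Set.mem_ofPred_eq, cr_mul_right, hd1, hd2]
    constructor <;> positivity)
  have h1 : 0 ≤ cr f.1 (s - x) := nonneg_of_forall_pos fun ε hε => (h ε hε).1
  have h2 : 0 ≤ cr f.2 (s - x) := nonneg_of_forall_pos fun ε hε => (h ε hε).2
  have hsx : s - x ≠ 0 := fun h => hxS (by rwa [← sub_eq_zero.1 h])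
  by_cases hz : cr f.1 (s - x) = 0
  · have h4 := eq_mul_of_cr_eq_zero hn1 hz
    set σ := dt f.1 (s - x)
    have hσ : σ ≠ 0 := by rintro h0; rw [h0] at h4; simp at h4; exact hsx h4
    have hs' : s = x + σ * f.1 := by rw [← h4]; ring
    rcases hσ.lt_or_gt with hσ | hσ
    · exact ⟨-σ, by linarith, Or.inl (by rw [hs'] at hs; simpa using hs)⟩
    · rw [h4, cr_mul_right, cr_comm] at h2
      have : cr f.1 f.2 = 0 := by nlinarith
      refine ⟨σ, hσ, Or.inr ?_⟩
      rw [hF.eq_of_cr_eq_zero hf this, ← hs']; exact hs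
  · have hz2 : cr f.2 (s - x) = 0 :=
      le_antisymm (not_lt.1 fun h => hfree s hs ⟨lt_of_le_of_ne h1 (Ne.symm hz), h⟩) h2
    have h4 := eq_mul_of_cr_eq_zero hn2 hz2
    set σ := dt f.2 (s - x)
    have hs' : s = x + σ * f.2 := by rw [← h4]; ring
    rw [h4, cr_mul_right] at h1 hz
    refine ⟨σ, ?_, Or.inr (by rwa [← hs'])⟩
    by_contra hσ
    push Not at hσ
    exact hz (le_antisymm (mul_nonpos_of_nonpos_of_nonneg hσ hcr) h1)

end IsGapFamily

end DirHull

/-! ### The vertices of the hull are charged to exposed points -/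

namespace DirHull

open Filter Topology

variable {F : Set (ℂ × ℂ)} {S : Set ℂ}

/-- The boundary of `C` coincides with a straight line near `x`. -/
def IsLocallyLine (C : Set ℂ) (x : ℂ) : Prop :=
  ∃ u : ℂ, u ≠ 0 ∧ ∃ ε : ℝ, 0 < ε ∧
    frontier C ∩ Metric.ball x ε = {z : ℂ | ∃ t : ℝ, z = x + (t : ℂ) * u} ∩ Metric.ball x ε

lemma isLocallyLine_of_sides {C : Set ℂ} (hC : IsClosed C) {x v : ℂ} (hv : ‖v‖ = 1) {ε : ℝ}
    (hε : 0 < ε) (hline : ∀ t : ℝ, |t| < ε → x + t * v ∈ C)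
    (hleft : ∀ y, ‖y - x‖ < ε → 0 < cr v (y - x) → y ∉ C)
    (hright : (∀ y, ‖y - x‖ < ε → cr v (y - x) < 0 → y ∈ C) ∨
      (∀ y, ‖y - x‖ < ε → cr v (y - x) < 0 → y ∉ C)) : IsLocallyLine C x := by
  have hv0 : v ≠ 0 := by rintro rfl; simp at hv
  refine ⟨v, hv0, ε, hε, ?_⟩
  have hcont : Continuous fun y => cr v (y - x) := by
    apply Continuous.cr <;> fun_prop
  ext y
  simp only [Set.mem_inter_iff, Metric.mem_ball, dist_eq_norm, Set.mem_ofPred_eq,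
    and_congr_left_iff]
  intro hy
  rw [hC.frontier_eq, Set.mem_sdiff]
  constructor
  · rintro ⟨hyC, hint⟩
    refine ⟨dt v (y - x), ?_⟩
    rw [← eq_mul_of_cr_eq_zero hv, add_sub_cancel]
    by_contra hne
    rcases lt_or_gt_of_ne hne with h | h
    · rcases hright with hr | hr
      · refine hint (mem_interior.2 ⟨{y | ‖y - x‖ < ε} ∩ {y | cr v (y - x) < 0},
          fun z hz => hr z hz.1 hz.2, ?_, hy, h⟩)
        exact (isOpen_lt (by fun_prop) continuous_const).inter (isOpen_lt hcont continuous_const)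
      · exact hr y hy h hyC
    · exact hleft y hy h hyC
  · rintro ⟨t, rfl⟩
    have ht : |t| < ε := by simpa [hv] using hy
    refine ⟨hline t ht, fun hint => ?_⟩
    -- points slightly to the left of the line are not in `C`
    have hlim : Tendsto (fun s : ℝ => x + t * v + s * (Complex.I * v)) (𝓝[>] 0)
        (𝓝 (x + t * v + (0 : ℝ) * (Complex.I * v))) :=
      (by fun_prop : Continuous fun s : ℝ => x + t * v + s * (Complex.I * v)).continuousAt.tendsto
        |>.mono_left nhdsWithin_le_nhds
    simp only [Complex.ofReal_zero, zero_mul, add_zero] at hlim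
    have hopen : IsOpen (interior C ∩ {y | ‖y - x‖ < ε}) :=
      isOpen_interior.inter (isOpen_lt (by fun_prop) continuous_const)
    obtain ⟨s, hs, hpos⟩ := ((hlim.eventually (hopen.mem_nhds ⟨hint, hy⟩)).and
      self_mem_nhdsWithin).exists
    refine hleft _ hs.2 ?_ (interior_subset hs.1)
    have : cr v (x + t * v + s * (Complex.I * v) - x) = s * dt v v := by
      simp [cr, dt]; ring
    rw [this, dt_self hv, mul_one]
    exact hpos

/-- `x` is the far end of the segment in which the hull meets the ray from `p` in the direction of
the first vector of a pair whose wedge with apex `x` is empty. -/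
def EndFst (F : Set (ℂ × ℂ)) (S : Set ℂ) (f : ℂ × ℂ) (p x : ℂ) : Prop :=
  f ∈ F ∧ p ∈ S ∧ Free S f x ∧ (∃ t : ℝ, 0 < t ∧ p = x - t * f.1) ∧
    ∀ τ : ℝ, 0 < τ → x + τ * f.1 ∉ hullOf F S

/-- The mirror image of `EndFst`. -/
def EndSnd (F : Set (ℂ × ℂ)) (S : Set ℂ) (f : ℂ × ℂ) (p x : ℂ) : Prop :=
  f ∈ F ∧ p ∈ S ∧ Free S f x ∧ (∃ t : ℝ, 0 < t ∧ p = x + t * f.2) ∧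
    ∀ τ : ℝ, 0 < τ → x - τ * f.2 ∉ hullOf F S

/-- `x` is the apex of an empty wedge that has a point of `S` on both of its sides, `p` being the
one on the first side. -/
def Corner (F : Set (ℂ × ℂ)) (S : Set ℂ) (f : ℂ × ℂ) (p x : ℂ) : Prop :=
  f ∈ F ∧ p ∈ S ∧ Free S f x ∧ (∃ t : ℝ, 0 < t ∧ p = x - t * f.1) ∧ 0 < cr f.1 f.2 ∧
    ∃ τ : ℝ, 0 < τ ∧ x + τ * f.2 ∈ S

namespace IsGapFamily

/-- An empty wedge with apex to the right of a chord of direction `v` of the hull is not given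
by two vectors that both form at most a right angle with `v`. -/
lemma dt_neg_of_free (hF : IsGapFamily F) {f : ℂ × ℂ} (hf : f ∈ F) {v x y : ℂ} (hv : (v, v) ∈ F)
    {t τ : ℝ} (hp : x - t * v ∈ hullOf F S) (hq : x + τ * v ∈ hullOf F S) (hfree : Free S f y)
    (hy : cr v (y - x) < 0) (hdt : |dt v (y - x)| < t) (hdτ : |dt v (y - x)| < τ) :
    dt f.1 v < 0 ∨ dt f.2 v < 0 := by
  by_contra! H
  have hvn := hF.norm_fst _ hv
  have q1 := cr_sq_add_dt_sq (hF.norm_fst f hf) hvn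
  have q2 := cr_sq_add_dt_sq (hF.norm_snd f hf) hvn
  simp only at q1 q2
  rw [abs_lt] at hdt hdτ
  -- applied to the coordinates of a unit vector in the frame of `v`
  have pos : ∀ {k δ c d : ℝ}, 0 < k → 0 < δ → 0 ≤ c → 0 ≤ d → c ^ 2 + d ^ 2 = 1 →
      0 < k * c + δ * d := by
    intro k δ c d hk hδ hc hd h
    rcases hc.lt_or_eq with h1 | h1
    · positivity
    · rcases hd.lt_or_eq with h2 | h2
      · positivity
      · rw [← h1, ← h2] at h; norm_num at h
  rcases hF.cr_same_sign hf hv with h | h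
  · refine hp f hf y hfree ?_
    have e : ∀ a, cr a (x - t * v - y)
        = (t + dt v (y - x)) * (-cr a v) + (-cr v (y - x)) * dt a v := by
      intro a
      rw [show x - t * v - y = -(y - x) - t * v by ring, cr_sub_right, cr_neg_right, cr_mul_right,
        cr_eq_of_unit hvn a (y - x)]
      ring
    simp only [wedge, Set.mem_ofPred_eq, e]
    exact ⟨pos (by linarith [hdt.1]) (by linarith) (by linarith) H.1
        (by linarith [neg_sq (cr f.1 v)]),
      pos (by linarith [hdt.1]) (by linarith) (by linarith) H.2 (by linarith [neg_sq (cr f.2 v)])⟩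
  · refine hq f hf y hfree ?_
    have e : ∀ a, cr a (x + τ * v - y)
        = (τ - dt v (y - x)) * cr a v + (-cr v (y - x)) * dt a v := by
      intro a
      rw [show x + τ * v - y = τ * v - (y - x) by ring, cr_sub_right, cr_mul_right,
        cr_eq_of_unit hvn a (y - x)]
      ring
    simp only [wedge, Set.mem_ofPred_eq, e]
    exact ⟨pos (by linarith [hdτ.2]) (by linarith) h.1 H.1 q1,
      pos (by linarith [hdτ.2]) (by linarith) h.2 H.2 q2⟩

/-- A point inside a chord of the hull whose left side is locally outside the hull, while its right
side is not locally inside it, is either locally outside the hull on the right side as well, or it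
is an end of the hull on a line through a point of `S`. -/
lemma right_removed (hF : IsGapFamily F) (hS : S.Finite) {v x : ℂ} (hv : (v, v) ∈ F)
    {t τ : ℝ} (ht : 0 < t) (hτ : 0 < τ) (hp : x - t * v ∈ hullOf F S)
    (hq : x + τ * v ∈ hullOf F S) {ε : ℝ} (hε : 0 < ε)
    (hl : ∀ y, ‖y - x‖ < ε → 0 < cr v (y - x) → y ∉ hullOf F S)
    (hr : x ∈ closure {y | cr v (y - x) < 0 ∧ y ∉ hullOf F S}) :
    (∃ δ : ℝ, 0 < δ ∧ ∀ y, ‖y - x‖ < δ → cr v (y - x) < 0 → y ∉ hullOf F S) ∨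
      ∃ f p, EndFst F S f p x ∨ EndSnd F S f p x := by
  have hvn := hF.norm_fst _ hv
  simp only at hvn
  obtain ⟨y, f, g, hg, hgx, hy, hf, hfy, hylim, hflim⟩ := hF.exists_free_limit (fun y h => h.2) hr
  have hg1 := hF.norm_fst g hg
  have hg2 := hF.norm_snd g hg
  -- the points `y k` eventually satisfy the hypotheses of `dt_neg_of_free`
  have hsmall : ∀ᶠ k in atTop, |dt v (y k - x)| < t ∧ |dt v (y k - x)| < τ := by
    have h0 : Tendsto (fun k => |dt v (y k - x)|) atTop (𝓝 |dt v (x - x)|) := by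
      have : Continuous fun z => |dt v (z - x)| := by
        apply Continuous.abs; apply Continuous.dt <;> fun_prop
      exact (this.tendsto x).comp hylim
    rw [sub_self, show dt v 0 = 0 by simp [dt], abs_zero] at h0
    exact (h0.eventually (gt_mem_nhds ht)).and (h0.eventually (gt_mem_nhds hτ))
  -- the limit wedge contains neither end of the chord, so it has a side parallel to the chord
  have hzero : cr g.1 v = 0 ∨ cr g.2 v = 0 := by
    have h1 := hp g hg x hgx
    have h2 := hq g hg x hgx
    rw [show x - t * v - x = -(t * v) by ring] at h1
    rw [show x + τ * v - x = τ * v by ring] at h2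
    simp only [wedge, Set.mem_ofPred_eq, cr_neg_right, cr_mul_right, neg_pos, not_and_or,
      not_lt] at h1 h2
    simp only [mul_nonneg_iff_of_pos_left ht, mul_nonpos_iff_pos_imp_nonpos] at h1 h2
    rcases hF.cr_same_sign hg hv with h | h
    · exact h1.imp (fun h' => le_antisymm h.1 h') fun h' => le_antisymm h.2 h'
    · exact h2.imp (fun h' => le_antisymm (h'.1 hτ) h.1) fun h' => le_antisymm (h'.1 hτ) h.2
  -- a side of direction `v` is impossible: if `g` is isolated, then `g` itself is the pair of some
  -- `y k`, and otherwise both vectors of the pairs of `y k` converge to `v`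
  have no_v : ¬ (g.1 = v ∨ g.2 = v) := by
    intro hgv
    rcases (hF.cr_nonneg g hg).lt_or_eq with hc | hc
    · obtain ⟨k, hk, hk'⟩ := (hsmall.and (hflim.eventually (hF.eventually_eq hg hc))).exists
      have h := hF.dt_neg_of_free (hf k) hv hp hq (hfy k) (hy k).1 hk.1 hk.2
      rw [hk' (hf k)] at h
      have hdt := hF.dt_nonneg g hg
      rcases hgv with hgv | hgv
      · rw [hgv, dt_self hvn, dt_comm] at h
        rw [hgv] at hdt
        rcases h with h | h <;> linarith
      · rw [hgv, dt_self hvn] at h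
        rw [hgv] at hdt
        rcases h with h | h <;> linarith
    · have heq := hF.eq_of_cr_eq_zero hg hc.symm
      have hgv1 : g.1 = v := by rcases hgv with h | h; exacts [h, by rw [← heq, h]]
      have hgv2 : g.2 = v := by rw [heq, hgv1]
      have ev : ∀ u : ℂ × ℂ → ℝ, Continuous u → 0 < u g → ∀ᶠ k in atTop, 0 < u (f k) :=
        fun u hu h => hflim.eventually (hu.continuousAt.eventually (lt_mem_nhds h))
      have e1 := ev (fun f => dt f.1 v) (by apply Continuous.dt <;> fun_prop)
        (by simp [hgv1, dt_self hvn])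
      have e2 := ev (fun f => dt f.2 v) (by apply Continuous.dt <;> fun_prop)
        (by simp [hgv2, dt_self hvn])
      obtain ⟨k, hk, h1, h2⟩ := (hsmall.and (e1.and e2)).exists
      rcases hF.dt_neg_of_free (hf k) hv hp hq (hfy k) (hy k).1 hk.1 hk.2 with h | h <;> linarith
  have hneg : g.1 = -v ∨ g.2 = -v := by
    push Not at no_v
    rcases hzero with h | h
    · rw [cr_comm, neg_eq_zero] at h
      exact Or.inl ((eq_or_eq_neg_of_cr_eq_zero hvn hg1 h).resolve_left no_v.1)
    · rw [cr_comm, neg_eq_zero] at h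
      exact Or.inr ((eq_or_eq_neg_of_cr_eq_zero hvn hg2 h).resolve_left no_v.2)
  rcases (hF.cr_nonneg g hg).lt_or_eq with hc | hc
  · rcases hneg with hn | hn
    · rcases hF.slide_fst hS hg hc hgx with ⟨ε', hε', hfr⟩ | ⟨σ, hσ, hs⟩
      · obtain ⟨δ, hδ, h⟩ := hF.removed_of_free_fst hg hc hε' hfr
        refine Or.inl ⟨δ, hδ, fun z hz hz' => h z hz ?_⟩
        rw [hn, cr_neg_left]; linarith
      · refine Or.inr ⟨g, _, Or.inr ⟨hg, hs, hgx, ⟨σ, hσ, rfl⟩, fun τ' hτ' hmem => ?_⟩⟩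
        have hpos : 0 < min τ' (ε / 2) := by positivity
        have hmem2 : x - (min τ' (ε / 2) : ℝ) * g.2 ∈ hullOf F S := by
          refine hF.mem_hullOf_of_between (hF.diag_snd g hg) (t := τ' - min τ' (ε / 2))
            (τ := σ + min τ' (ε / 2)) (by simp) (by positivity) ?_ ?_
          · convert hmem using 1; push_cast; ring
          · convert subset_hullOf hs using 1; push_cast; ring
        refine hl _ ?_ ?_ hmem2
        · rw [sub_sub_cancel_left, norm_neg, norm_mul, hg2, mul_one, Complex.norm_real,
            Real.norm_of_nonneg hpos.le]
          exact (min_le_right _ _).trans_lt (by linarith)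
        · rw [hn, cr_neg_left] at hc
          rw [sub_sub_cancel_left, cr_neg_right, cr_mul_right]
          nlinarith
    · rcases hF.slide_snd hS hg hc hgx with ⟨ε', hε', hfr⟩ | ⟨σ, hσ, hs⟩
      · obtain ⟨δ, hδ, h⟩ := hF.removed_of_free_snd hg hc hε' hfr
        refine Or.inl ⟨δ, hδ, fun z hz hz' => h z hz ?_⟩
        rw [hn, cr_neg_left]; linarith
      · refine Or.inr ⟨g, _, Or.inl ⟨hg, hs, hgx, ⟨σ, hσ, rfl⟩, fun τ' hτ' hmem => ?_⟩⟩
        have hpos : 0 < min τ' (ε / 2) := by positivity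
        have hmem2 : x + (min τ' (ε / 2) : ℝ) * g.1 ∈ hullOf F S := by
          refine hF.mem_hullOf_of_between (hF.diag_fst g hg) (t := σ + min τ' (ε / 2))
            (τ := τ' - min τ' (ε / 2)) (by positivity) (by simp) ?_ ?_
          · convert subset_hullOf hs using 1; push_cast; ring
          · convert hmem using 1; push_cast; ring
        refine hl _ ?_ ?_ hmem2
        · rw [add_sub_cancel_left, norm_mul, hg1, mul_one, Complex.norm_real,
            Real.norm_of_nonneg hpos.le]
          exact (min_le_right _ _).trans_lt (by linarith)
        · rw [hn, cr_neg_right, cr_comm, neg_neg] at hc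
          rw [add_sub_cancel_left, cr_mul_right]
          exact mul_pos hpos hc
  · have heq := hF.eq_of_cr_eq_zero hg hc.symm
    have h1 : g.1 = -v := by rcases hneg with h | h; exacts [h, by rw [← heq, h]]
    refine Or.inl ⟨1, one_pos, fun z _ hz hmem => hmem g hg x hgx ?_⟩
    simp only [wedge, Set.mem_ofPred_eq, heq, h1, cr_neg_left]
    exact ⟨by linarith, by linarith⟩

/-- A point inside a chord of the hull whose left side is locally outside the hull is not a vertex,
unless it is an end of the hull on another line through a point of `S`. -/
lemma isLocallyLine_or_end (hF : IsGapFamily F) (hS : S.Finite) {v x : ℂ} (hv : (v, v) ∈ F)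
    {t τ : ℝ} (ht : 0 < t) (hτ : 0 < τ) (hp : x - t * v ∈ hullOf F S)
    (hq : x + τ * v ∈ hullOf F S) {ε : ℝ} (hε : 0 < ε)
    (hl : ∀ y, ‖y - x‖ < ε → 0 < cr v (y - x) → y ∉ hullOf F S) :
    IsLocallyLine (hullOf F S) x ∨ ∃ f p, EndFst F S f p x ∨ EndSnd F S f p x := by
  have hline : ∀ r : ℝ, |r| < min t τ → x + r * v ∈ hullOf F S := by
    intro r hr
    rw [abs_lt] at hr
    have h1 := min_le_left t τ
    have h2 := min_le_right t τ
    refine hF.mem_hullOf_of_between hv (t := t + r) (τ := τ - r) (by linarith) (by linarith) ?_ ?_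
    · convert hp using 1; push_cast; ring
    · convert hq using 1; push_cast; ring
  have key : ∀ δ : ℝ, 0 < δ → ((∀ y, ‖y - x‖ < δ → cr v (y - x) < 0 → y ∈ hullOf F S) ∨
      (∀ y, ‖y - x‖ < δ → cr v (y - x) < 0 → y ∉ hullOf F S)) →
      IsLocallyLine (hullOf F S) x := by
    intro δ hδ h
    refine isLocallyLine_of_sides isClosed_hullOf (hF.norm_fst _ hv)
      (ε := min (min t τ) (min ε δ)) (by positivity)
      (fun r hr => hline r (hr.trans_le (min_le_left _ _)))
      (fun y hy => hl y (hy.trans_le ((min_le_right _ _).trans (min_le_left _ _)))) ?_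
    refine h.imp ?_ ?_ <;>
    exact fun h y hy => h y (hy.trans_le ((min_le_right _ _).trans (min_le_right _ _)))
  by_cases hr : x ∈ closure {y | cr v (y - x) < 0 ∧ y ∉ hullOf F S}
  · refine (hF.right_removed hS hv ht hτ hp hq hε hl hr).imp_left ?_
    rintro ⟨δ, hδ, h⟩
    exact key δ hδ (Or.inr h)
  · left
    rw [Metric.mem_closure_iff] at hr
    push Not at hr
    obtain ⟨δ, hδ, h⟩ := hr
    refine key δ hδ (Or.inl fun y hy hy' => ?_)
    by_contra hmem
    have := h y ⟨hy', hmem⟩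
    rw [dist_comm, dist_eq_norm] at this
    linarith

/-- The three kinds of vertices of the hull that are not points of `S`. -/
lemma end_or_corner_of_vertex (hF : IsGapFamily F) (hS : S.Finite) {x : ℂ}
    (hx : x ∈ frontier (hullOf F S)) (hxS : x ∉ S) (hnl : ¬ IsLocallyLine (hullOf F S) x) :
    ∃ f p, EndFst F S f p x ∨ EndSnd F S f p x ∨ Corner F S f p x := by
  obtain ⟨f, hf, hfree⟩ := hF.exists_free_of_mem_frontier hx
  have hmem : x ∈ hullOf F S := isClosed_hullOf.frontier_subset hx
  by_contra! H
  have H' : ¬ ∃ f p, EndFst F S f p x ∨ EndSnd F S f p x := by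
    rintro ⟨f, p, h | h⟩
    · exact (H f p).1 h
    · exact (H f p).2.1 h
  obtain ⟨t, ht, hp | hp⟩ := hF.exists_mem_ray hS hf hmem hxS hfree
  · have hend : ∃ τ : ℝ, 0 < τ ∧ x + τ * f.1 ∈ hullOf F S := by
      by_contra! hno
      exact (H f _).1 ⟨hf, hp, hfree, ⟨t, ht, rfl⟩, hno⟩
    obtain ⟨τ, hτ, hq⟩ := hend
    have hrem : ∃ δ : ℝ, 0 < δ ∧ ∀ y, ‖y - x‖ < δ → 0 < cr f.1 (y - x) → y ∉ hullOf F S := by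
      rcases (hF.cr_nonneg f hf).lt_or_eq with hc | hc
      · rcases hF.slide_fst hS hf hc hfree with ⟨ε, hε, hfr⟩ | ⟨σ, hσ, hs⟩
        · exact hF.removed_of_free_fst hf hc hε hfr
        · exact ((H f _).2.2 ⟨hf, hp, hfree, ⟨t, ht, rfl⟩, hc, σ, hσ, hs⟩).elim
      · refine ⟨1, one_pos, fun y _ hy hm => hm f hf x hfree ⟨hy, ?_⟩⟩
        rwa [hF.eq_of_cr_eq_zero hf hc.symm]
    obtain ⟨δ, hδ, hrem⟩ := hrem
    rcases hF.isLocallyLine_or_end hS (hF.diag_fst f hf) ht hτ (subset_hullOf hp) hq hδ hrem with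
      h | h
    · exact hnl h
    · exact H' h
  · have hend : ∃ τ : ℝ, 0 < τ ∧ x - τ * f.2 ∈ hullOf F S := by
      by_contra! hno
      exact (H f _).2.1 ⟨hf, hp, hfree, ⟨t, ht, rfl⟩, hno⟩
    obtain ⟨τ, hτ, hq⟩ := hend
    have hrem : ∃ δ : ℝ, 0 < δ ∧ ∀ y, ‖y - x‖ < δ → 0 < cr f.2 (y - x) → y ∉ hullOf F S := by
      rcases (hF.cr_nonneg f hf).lt_or_eq with hc | hc
      · rcases hF.slide_snd hS hf hc hfree with ⟨ε, hε, hfr⟩ | ⟨σ, hσ, hs⟩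
        · exact hF.removed_of_free_snd hf hc hε hfr
        · exact ((H f _).2.2 ⟨hf, hs, hfree, ⟨σ, hσ, rfl⟩, hc, t, ht, hp⟩).elim
      · refine ⟨1, one_pos, fun y _ hy hm => hm f hf x hfree ⟨?_, hy⟩⟩
        rwa [← hF.eq_of_cr_eq_zero hf hc.symm]
    obtain ⟨δ, hδ, hrem⟩ := hrem
    rcases hF.isLocallyLine_or_end hS (hF.diag_snd f hf) hτ ht hq (subset_hullOf hp) hδ hrem with
      h | h
    · exact hnl h
    · exact H' h

/-! ### Each exposed point is charged a bounded number of times -/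

/-- If `p` charges `x` and `x'` along first sides, then the direction of the second charge is not to
the left of the first one, since `x'` would then be inside the empty wedge with apex `x`. -/
lemma cr_fst_nonpos (hF : IsGapFamily F) {f f' : ℂ × ℂ} (hf : f ∈ F) (hf' : f' ∈ F)
    {p x x' : ℂ} {t t' : ℝ} (ht : 0 < t) (ht' : 0 < t') (hx : p = x - t * f.1)
    (hx' : p = x' - t' * f'.1) (hmem : x' ∈ hullOf F S) (hfree : Free S f x) :
    cr f.1 f'.1 ≤ 0 := by
  by_contra! h
  have h1 := hF.gap f hf _ (hF.diag_fst f' hf')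
  have h2 : cr f'.1 f.2 ≤ 0 := not_lt.1 fun h' => h1 ⟨h, h'⟩
  refine hmem f hf x hfree ?_
  have e : x' - x = t' * f'.1 - t * f.1 := by linear_combination hx - hx'
  rw [e]
  simp only [wedge, Set.mem_ofPred_eq, cr_sub_right, cr_mul_right, cr_self]
  refine ⟨by nlinarith, ?_⟩
  rw [cr_comm f.2 f'.1, cr_comm f.2 f.1]
  rcases (hF.cr_nonneg f hf).lt_or_eq with hc | hc
  · nlinarith
  · rw [hF.eq_of_cr_eq_zero hf hc.symm, cr_self, cr_comm]
    nlinarith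

/-- The mirror image of `cr_fst_nonpos`. -/
lemma cr_snd_nonneg (hF : IsGapFamily F) {f f' : ℂ × ℂ} (hf : f ∈ F) (hf' : f' ∈ F)
    {p x x' : ℂ} {t t' : ℝ} (ht : 0 < t) (ht' : 0 < t') (hx : p = x + t * f.2)
    (hx' : p = x' + t' * f'.2) (hmem : x' ∈ hullOf F S) (hfree : Free S f x) :
    0 ≤ cr f.2 f'.2 := by
  by_contra! h
  have h1 := hF.gap f hf _ (hF.diag_snd f' hf')
  have h3 := cr_comm f'.2 f.2
  have h2 : cr f.1 f'.2 ≤ 0 := not_lt.1 fun h' => h1 ⟨h', by linarith⟩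
  refine hmem f hf x hfree ?_
  have e : x' - x = t * f.2 - t' * f'.2 := by linear_combination hx - hx'
  rw [e]
  simp only [wedge, Set.mem_ofPred_eq, cr_sub_right, cr_mul_right, cr_self]
  refine ⟨?_, by nlinarith⟩
  rcases (hF.cr_nonneg f hf).lt_or_eq with hc | hc
  · nlinarith
  · have heq := hF.eq_of_cr_eq_zero hf hc.symm
    rw [← heq, cr_self]
    nlinarith

lemma fst_eq_or_eq_neg (hF : IsGapFamily F) {f f' : ℂ × ℂ} (hf : f ∈ F) (hf' : f' ∈ F)
    {p x x' : ℂ} {t t' : ℝ} (ht : 0 < t) (ht' : 0 < t') (hx : p = x - t * f.1)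
    (hx' : p = x' - t' * f'.1) (hmem : x ∈ hullOf F S) (hmem' : x' ∈ hullOf F S)
    (hfree : Free S f x) (hfree' : Free S f' x') : f'.1 = f.1 ∨ f'.1 = -f.1 := by
  have h1 := hF.cr_fst_nonpos hf hf' ht ht' hx hx' hmem' hfree
  have h2 := hF.cr_fst_nonpos hf' hf ht' ht hx' hx hmem hfree'
  rw [cr_comm] at h2
  exact eq_or_eq_neg_of_cr_eq_zero (hF.norm_fst f hf) (hF.norm_fst f' hf') (by linarith)

lemma snd_eq_or_eq_neg (hF : IsGapFamily F) {f f' : ℂ × ℂ} (hf : f ∈ F) (hf' : f' ∈ F)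
    {p x x' : ℂ} {t t' : ℝ} (ht : 0 < t) (ht' : 0 < t') (hx : p = x + t * f.2)
    (hx' : p = x' + t' * f'.2) (hmem : x ∈ hullOf F S) (hmem' : x' ∈ hullOf F S)
    (hfree : Free S f x) (hfree' : Free S f' x') : f'.2 = f.2 ∨ f'.2 = -f.2 := by
  have h1 := hF.cr_snd_nonneg hf hf' ht ht' hx hx' hmem' hfree
  have h2 := hF.cr_snd_nonneg hf' hf ht' ht hx' hx hmem hfree'
  rw [cr_comm] at h2
  exact eq_or_eq_neg_of_cr_eq_zero (hF.norm_snd f hf) (hF.norm_snd f' hf') (by linarith)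

end IsGapFamily

/-- A choice of one out of every two opposite directions. -/
def IsUpper (v : ℂ) : Prop := 0 < v.im ∨ (v.im = 0 ∧ 0 < v.re)

lemma eq_of_isUpper_iff {v w : ℂ} (hv : ‖v‖ = 1) (h : w = v ∨ w = -v)
    (hu : IsUpper v ↔ IsUpper w) : w = v := by
  refine h.resolve_right fun hw => ?_
  have h1 := dt_self hv
  simp only [IsUpper, hw, Complex.neg_im, Complex.neg_re, dt] at hu h1
  rcases lt_trichotomy v.im 0 with h | h | h
  · exact absurd (hu.2 (Or.inl (by linarith))) (by rintro (h' | h') <;> linarith)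
  · rcases lt_trichotomy v.re 0 with h' | h' | h'
    · exact absurd (hu.2 (Or.inr ⟨by linarith, by linarith⟩)) (by rintro (h' | h') <;> linarith)
    · rw [h, h'] at h1; norm_num at h1
    · exact absurd (hu.1 (Or.inr ⟨by linarith, by linarith⟩)) (by rintro (h' | h') <;> linarith)
  · exact absurd (hu.1 (Or.inl (by linarith))) (by rintro (h' | h') <;> linarith)

namespace IsGapFamily

lemma eq_of_endFst (hF : IsGapFamily F) {f f' : ℂ × ℂ} {p x x' : ℂ} (hx : x ∈ hullOf F S)
    (hx' : x' ∈ hullOf F S) (h : EndFst F S f p x) (h' : EndFst F S f' p x')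
    (hu : IsUpper f.1 ↔ IsUpper f'.1) : x = x' := by
  obtain ⟨hf, _, hfree, ⟨t, ht, hp⟩, hno⟩ := h
  obtain ⟨hf', _, hfree', ⟨t', ht', hp'⟩, hno'⟩ := h'
  have heq := eq_of_isUpper_iff (hF.norm_fst f hf)
    (hF.fst_eq_or_eq_neg hf hf' ht ht' hp hp' hx hx' hfree hfree') hu
  rw [heq] at hp' hno'
  have e : x' = x + (t' - t : ℝ) * f.1 := by push_cast; linear_combination hp - hp'
  rcases lt_trichotomy t t' with h | h | h
  · exact (hno _ (sub_pos.2 h) (e ▸ hx')).elim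
  · rw [e, h]; simp
  · refine (hno' (t - t') (sub_pos.2 h) ?_).elim
    convert hx using 1; push_cast; linear_combination hp - hp'

lemma eq_of_endSnd (hF : IsGapFamily F) {f f' : ℂ × ℂ} {p x x' : ℂ} (hx : x ∈ hullOf F S)
    (hx' : x' ∈ hullOf F S) (h : EndSnd F S f p x) (h' : EndSnd F S f' p x')
    (hu : IsUpper f.2 ↔ IsUpper f'.2) : x = x' := by
  obtain ⟨hf, _, hfree, ⟨t, ht, hp⟩, hno⟩ := h
  obtain ⟨hf', _, hfree', ⟨t', ht', hp'⟩, hno'⟩ := h'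
  have heq := eq_of_isUpper_iff (hF.norm_snd f hf)
    (hF.snd_eq_or_eq_neg hf hf' ht ht' hp hp' hx hx' hfree hfree') hu
  rw [heq] at hp' hno'
  have e : x' = x - (t' - t : ℝ) * f.2 := by push_cast; linear_combination hp - hp'
  rcases lt_trichotomy t t' with h | h | h
  · exact (hno _ (sub_pos.2 h) (e ▸ hx')).elim
  · rw [e, h]; simp
  · refine (hno' (t - t') (sub_pos.2 h) ?_).elim
    convert hx using 1; push_cast; linear_combination hp - hp'

/-- Of two corners on a ray from `p`, the nearer one has a point of `S` on its second side that lies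
in the wedge of the farther one. -/
lemma not_corner_of_lt (hF : IsGapFamily F) {f f' : ℂ × ℂ} {x x' : ℂ} {t : ℝ} (ht : 0 < t)
    (heq : f'.1 = f.1) (hx : x' = x + t * f.1) (hf : f ∈ F) (hf' : f' ∈ F)
    (hc : 0 < cr f.1 f.2) (hc' : 0 < cr f'.1 f'.2) {τ : ℝ} (hτ : 0 < τ) (hs : x + τ * f.2 ∈ S) :
    ¬ Free S f' x' := by
  intro hfree
  refine hfree _ hs ?_
  have h1 := hF.gap f hf _ (hF.diag_snd f' hf')
  have h2 := hF.gap f' hf' _ (hF.diag_snd f hf)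
  rw [heq] at hc' h2
  have h3 : cr f'.2 f.2 ≤ 0 := not_lt.1 fun h => h1 ⟨hc', h⟩
  have h4 : cr f.2 f'.2 ≤ 0 := not_lt.1 fun h => h2 ⟨hc, h⟩
  rw [cr_comm] at h4
  rw [show x + τ * f.2 - x' = τ * f.2 - t * f.1 by rw [hx]; ring]
  simp only [wedge, Set.mem_ofPred_eq, heq, cr_sub_right, cr_mul_right, cr_self,
    show cr f'.2 f.2 = 0 by linarith, cr_comm f'.2 f.1]
  exact ⟨by nlinarith, by nlinarith⟩

lemma eq_of_corner (hF : IsGapFamily F) {f f' : ℂ × ℂ} {p x x' : ℂ} (hx : x ∈ hullOf F S)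
    (hx' : x' ∈ hullOf F S) (h : Corner F S f p x) (h' : Corner F S f' p x')
    (hu : IsUpper f.1 ↔ IsUpper f'.1) : x = x' := by
  obtain ⟨hf, _, hfree, ⟨t, ht, hp⟩, hc, τ, hτ, hs⟩ := h
  obtain ⟨hf', _, hfree', ⟨t', ht', hp'⟩, hc', τ', hτ', hs'⟩ := h'
  have heq := eq_of_isUpper_iff (hF.norm_fst f hf)
    (hF.fst_eq_or_eq_neg hf hf' ht ht' hp hp' hx hx' hfree hfree') hu
  have e : x' = x + (t' - t : ℝ) * f.1 := by
    push_cast; rw [heq] at hp'; linear_combination hp - hp'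
  rcases lt_trichotomy t t' with h | h | h
  · exact (hF.not_corner_of_lt (sub_pos.2 h) heq e hf hf' hc hc' hτ hs hfree').elim
  · rw [e, h]; simp
  · refine (hF.not_corner_of_lt (sub_pos.2 h) heq.symm ?_ hf' hf hc' hc hτ' hs' hfree).elim
    rw [heq, e]; push_cast; ring

lemma free_of_sub (hF : IsGapFamily F) {f : ℂ × ℂ} (hf : f ∈ F) {x : ℂ} {t : ℝ} (ht : 0 < t)
    (h : Free S f x) : Free S f (x - t * f.1) := by
  intro s hs hw
  rw [show s - (x - t * f.1) = (s - x) + t * f.1 by ring] at hw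
  simp only [wedge, Set.mem_ofPred_eq, cr_add_right, cr_mul_right, cr_self, cr_comm f.2 f.1] at hw
  have := hF.cr_nonneg f hf
  exact h s hs ⟨by linarith [hw.1], by nlinarith [hw.2]⟩

lemma free_of_add (hF : IsGapFamily F) {f : ℂ × ℂ} (hf : f ∈ F) {x : ℂ} {t : ℝ} (ht : 0 < t)
    (h : Free S f x) : Free S f (x + t * f.2) := by
  intro s hs hw
  rw [show s - (x + t * f.2) = (s - x) - t * f.2 by ring] at hw
  simp only [wedge, Set.mem_ofPred_eq, cr_sub_right _ _ (t * f.2), cr_mul_right, cr_self] at hw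
  have := hF.cr_nonneg f hf
  exact h s hs ⟨by nlinarith [hw.1], by linarith [hw.2]⟩

/-- The hull of a finite set has at most seven vertices for each point that is the apex of an empty
wedge. -/
theorem encard_vertices_le (hF : IsGapFamily F) (hS : S.Finite) :
    (vertices (hullOf F S)).encard ≤ 7 * {p ∈ S | ∃ f ∈ F, Free S f p}.encard := by
  classical
  set E := {p ∈ S | ∃ f ∈ F, Free S f p} with hE
  have hfr : ∀ x ∈ vertices (hullOf F S), x ∈ hullOf F S := fun x hx =>
    isClosed_hullOf.frontier_subset hx.1
  -- the label of a vertex records its kind and the side of its charge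
  let R : Option (Fin 3 × Bool) → ℂ → ℂ → Prop := fun l p x => match l with
    | none => x = p
    | some (0, b) => ∃ f, EndFst F S f p x ∧ (IsUpper f.1 ↔ b = true)
    | some (1, b) => ∃ f, EndSnd F S f p x ∧ (IsUpper f.2 ↔ b = true)
    | some (2, b) => ∃ f, Corner F S f p x ∧ (IsUpper f.1 ↔ b = true)
  have hR : ∀ x ∈ vertices (hullOf F S), ∃ lp : Option (Fin 3 × Bool) × ℂ,
      lp.2 ∈ E ∧ R lp.1 lp.2 x := by
    intro x hx
    by_cases hxS : x ∈ S
    · exact ⟨(none, x), ⟨hxS, hF.exists_free_of_mem_frontier hx.1⟩, rfl⟩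
    · obtain ⟨f, p, h | h | h⟩ := hF.end_or_corner_of_vertex hS hx.1 hxS hx.2
      · obtain ⟨hf, hp, hfree, ⟨t, ht, e⟩, _⟩ := id h
        exact ⟨(some (0, decide (IsUpper f.1)), p), ⟨hp, f, hf, e ▸ hF.free_of_sub hf ht hfree⟩,
          f, h, by simp⟩
      · obtain ⟨hf, hp, hfree, ⟨t, ht, e⟩, _⟩ := id h
        exact ⟨(some (1, decide (IsUpper f.2)), p), ⟨hp, f, hf, e ▸ hF.free_of_add hf ht hfree⟩,
          f, h, by simp⟩
      · obtain ⟨hf, hp, hfree, ⟨t, ht, e⟩, _⟩ := id h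
        exact ⟨(some (2, decide (IsUpper f.1)), p), ⟨hp, f, hf, e ▸ hF.free_of_sub hf ht hfree⟩,
          f, h, by simp⟩
  have huniq : ∀ l p, ∀ x ∈ vertices (hullOf F S), ∀ x' ∈ vertices (hullOf F S),
      R l p x → R l p x' → x = x' := by
    rintro (_ | ⟨k, b⟩) p x hx x' hx' h h'
    · exact h.trans h'.symm
    · fin_cases k
      · obtain ⟨⟨f, h, hb⟩, f', h', hb'⟩ := And.intro h h'
        exact hF.eq_of_endFst (hfr x hx) (hfr x' hx') h h' (hb.trans hb'.symm)
      · obtain ⟨⟨f, h, hb⟩, f', h', hb'⟩ := And.intro h h'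
        exact hF.eq_of_endSnd (hfr x hx) (hfr x' hx') h h' (hb.trans hb'.symm)
      · obtain ⟨⟨f, h, hb⟩, f', h', hb'⟩ := And.intro h h'
        exact hF.eq_of_corner (hfr x hx) (hfr x' hx') h h' (hb.trans hb'.symm)
  choose! φ hφE hφR using hR
  have hinj : Set.InjOn φ (vertices (hullOf F S)) := by
    intro x hx x' hx' h
    exact huniq (φ x).1 (φ x).2 x hx x' hx' (hφR x hx) (h ▸ hφR x' hx')
  have hmaps : Set.MapsTo φ (vertices (hullOf F S)) (Set.univ ×ˢ E) := fun x hx =>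
    ⟨trivial, hφE x hx⟩
  refine (Set.encard_le_encard_of_injOn hmaps hinj).trans (le_of_eq ?_)
  rw [Set.encard_prod]
  congr 1
  rw [Set.encard_univ]
  simp [ENat.card_eq_coe_fintype_card]

end IsGapFamily

end DirHull

/-! ### The family of wedges of a set of directions -/

namespace DirHull

open Filter Topology

/-- The pairs `(v, v)` for `v ∈ D`, whose wedges are the half-planes induced by `D`, and the pairs
of consecutive vectors of `D`, whose wedges are the quadrants induced by `D`. -/
def dirPairs (D : Set ℂ) : Set (ℂ × ℂ) :=
  {f | f.1 ∈ D ∧ f.2 ∈ D ∧ (f.1 = f.2 ∨ IsDPair D f.1 f.2)}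

lemma ccwAngle_nonneg (v w : ℂ) : 0 ≤ ccwAngle v w := left_le_toIcoMod _ _ _

lemma ccwAngle_lt_two_pi (v w : ℂ) : ccwAngle v w < 2 * Real.pi := by
  simpa [ccwAngle] using toIcoMod_lt_right Real.two_pi_pos 0 (Complex.arg (w / v))

lemma ccwAngle_neg_neg (v w : ℂ) : ccwAngle (-v) (-w) = ccwAngle v w := by
  simp [ccwAngle]

lemma div_eq_of_unit {v : ℂ} (hv : ‖v‖ = 1) (w : ℂ) : w / v = ⟨dt v w, cr v w⟩ := by
  have h1 := dt_self hv
  have hv0 : v ≠ 0 := by rintro rfl; simp at hv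
  rw [div_eq_iff hv0]
  simp only [dt] at h1
  apply Complex.ext
  · simp [dt, cr]; linear_combination (-w.re) * h1
  · simp [dt, cr]; linear_combination (-w.im) * h1

lemma cos_sin_ccwAngle {v w : ℂ} (hv : ‖v‖ = 1) (hw : ‖w‖ = 1) :
    Real.cos (ccwAngle v w) = dt v w ∧ Real.sin (ccwAngle v w) = cr v w := by
  have hn : ‖w / v‖ = 1 := by rw [norm_div, hv, hw, div_one]
  have h0 : w / v ≠ 0 := by intro h; rw [h] at hn; simp at hn
  have e : ccwAngle v w = Complex.arg (w / v)
      - toIcoDiv Real.two_pi_pos 0 (Complex.arg (w / v)) * (2 * Real.pi) := by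
    rw [ccwAngle, toIcoMod, zsmul_eq_mul]
  rw [e, Real.cos_sub_int_mul_two_pi, Real.sin_sub_int_mul_two_pi, Complex.cos_arg h0,
    Complex.sin_arg, hn, div_one, div_one, div_eq_of_unit hv]
  exact ⟨rfl, rfl⟩

lemma bddAbove_angles (D : Set ℂ) :
    BddAbove {θ : ℝ | ∃ v₁ v₂ : ℂ, IsDPair D v₁ v₂ ∧ θ = ccwAngle v₁ v₂} :=
  ⟨2 * Real.pi, by rintro _ ⟨v, w, _, rfl⟩; exact (ccwAngle_lt_two_pi v w).le⟩

lemma density_nonneg (D : Set ℂ) : 0 ≤ density D :=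
  Real.sSup_nonneg (by rintro _ ⟨v, w, _, rfl⟩; exact ccwAngle_nonneg v w)

lemma IsDPair.ccwAngle_le {D : Set ℂ} {v w : ℂ} (h : IsDPair D v w) :
    ccwAngle v w ≤ density D := le_csSup (bddAbove_angles D) ⟨v, w, h, rfl⟩

lemma IsDPair.neg {D : Set ℂ} (hD : IsDirectionSet D) {v w : ℂ} (h : IsDPair D v w) :
    IsDPair D (-v) (-w) := by
  obtain ⟨h1, h2, h3, h4⟩ := h
  refine ⟨(hD v h1).2, (hD w h2).2, by simpa using h3, fun u hu => ?_⟩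
  rw [ccwAngle_neg_neg, ← ccwAngle_neg_neg, neg_neg]
  exact h4 _ (hD u hu).2

variable {D : Set ℂ}

lemma IsDPair.ccwAngle_pos (hD : IsDirectionSet D) {v w : ℂ} (h : IsDPair D v w) :
    0 < ccwAngle v w := by
  refine lt_of_le_of_ne (ccwAngle_nonneg v w) fun h0 => h.2.2.1 ?_
  have h1 := cos_sin_ccwAngle (hD v h.1).1 (hD w h.2.1).1
  rw [← h0, Real.cos_zero, Real.sin_zero] at h1
  exact (DirHull.eq_of_cr_eq_zero (hD v h.1).1 (hD w h.2.1).1 h1.2.symm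
    (by rw [← h1.1]; exact zero_le_one)).symm

lemma IsDPair.cr_pos (hD : IsDirectionSet D) (hα : density D ≤ Real.pi / 2)
    {v w : ℂ} (h : IsDPair D v w) : 0 < cr v w := by
  rw [← (cos_sin_ccwAngle (hD v h.1).1 (hD w h.2.1).1).2]
  exact Real.sin_pos_of_pos_of_lt_pi (h.ccwAngle_pos hD)
    (by linarith [h.ccwAngle_le, Real.pi_pos])

lemma IsDPair.dt_nonneg (hD : IsDirectionSet D) (hα : density D ≤ Real.pi / 2)
    {v w : ℂ} (h : IsDPair D v w) : 0 ≤ dt v w := by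
  rw [← (cos_sin_ccwAngle (hD v h.1).1 (hD w h.2.1).1).1]
  exact Real.cos_nonneg_of_mem_Icc ⟨by linarith [ccwAngle_nonneg v w, Real.pi_pos],
    h.ccwAngle_le.trans hα⟩

lemma IsDPair.one_sub_le_dt (hD : IsDirectionSet D) {v w : ℂ} (h : IsDPair D v w) :
    1 - density D ^ 2 / 2 ≤ dt v w := by
  rw [← (cos_sin_ccwAngle (hD v h.1).1 (hD w h.2.1).1).1]
  have := Real.one_sub_sq_div_two_le_cos (x := ccwAngle v w)
  have h2 := pow_le_pow_left₀ (ccwAngle_nonneg v w) h.ccwAngle_le 2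
  linarith

/-- The definition of consecutive vectors, in terms of cross products. -/
lemma IsDPair.not_between (hD : IsDirectionSet D) (hα : density D ≤ Real.pi / 2)
    {v w u : ℂ} (h : IsDPair D v w) (hu : u ∈ D) :
    ¬ (0 < cr v u ∧ 0 < cr u w) := by
  rintro ⟨h1, h2⟩
  have hvn := (hD v h.1).1
  have hun := (hD u hu).1
  have hwn := (hD w h.2.1).1
  obtain ⟨c1, s1⟩ := cos_sin_ccwAngle hvn hun
  obtain ⟨c2, s2⟩ := cos_sin_ccwAngle hvn hwn
  have hθ := h.ccwAngle_le.trans hα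
  have hθ0 := h.ccwAngle_pos hD
  have hpi := Real.pi_pos
  have hφ := ccwAngle_nonneg v u
  have hφ2 := ccwAngle_lt_two_pi v u
  have hφpos : 0 < ccwAngle v u := by
    refine lt_of_le_of_ne hφ fun h0 => ?_
    rw [← h0, Real.sin_zero] at s1; linarith
  have hφpi : ccwAngle v u < Real.pi := by
    by_contra! hge
    have := Real.sin_nonneg_of_nonneg_of_le_pi (x := ccwAngle v u - Real.pi) (by linarith)
      (by linarith)
    rw [Real.sin_sub_pi] at this
    linarith
  refine h.2.2.2 u hu ⟨hφpos, ?_⟩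
  by_contra! hge
  have h3 : Real.sin (ccwAngle v w - ccwAngle v u) = cr u w := by
    rw [Real.sin_sub, c1, s1, c2, s2]
    have := dt_self hvn
    have e : cr v w * dt v u - dt v w * cr v u = dt v v * cr u w := by
      simp only [cr, dt]; ring
    rw [e, this, one_mul]
  have := Real.sin_nonpos_of_nonpos_of_neg_pi_le (x := ccwAngle v w - ccwAngle v u) (by linarith)
    (by linarith)
  linarith

lemma closure_dirPairs_induction {p : ℂ × ℂ → Prop} (hp : IsClosed {f | p f})
    (h : ∀ f ∈ dirPairs D, p f) {f : ℂ × ℂ} (hf : f ∈ closure (dirPairs D)) : p f :=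
  closure_minimal (t := {f | p f}) h hp hf

/-- The closure of the pairs of a set of directions is a gap family. Passing to the closure also
takes care of sets of directions that are not closed. -/
lemma isGapFamily_closure (hD : IsDirectionSet D) (hα : density D ≤ Real.pi / 2) :
    IsGapFamily (closure (dirPairs D)) where
  closed := isClosed_closure
  norm_fst f hf := closure_dirPairs_induction (p := fun f => ‖f.1‖ = 1)
    (isClosed_eq (by fun_prop) (by fun_prop)) (fun f hf => (hD _ hf.1).1) hf
  norm_snd f hf := closure_dirPairs_induction (p := fun f => ‖f.2‖ = 1)
    (isClosed_eq (by fun_prop) (by fun_prop)) (fun f hf => (hD _ hf.2.1).1) hf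
  cr_nonneg f hf := closure_dirPairs_induction (p := fun f => 0 ≤ cr f.1 f.2)
    (isClosed_le continuous_const continuous_cr) (by
      rintro f ⟨_, _, h | h⟩
      · rw [h, cr_self]
      · exact (h.cr_pos hD hα).le) hf
  dt_nonneg f hf := closure_dirPairs_induction (p := fun f => 0 ≤ dt f.1 f.2)
    (isClosed_le continuous_const continuous_dt) (by
      rintro f ⟨_, h2, h | h⟩
      · rw [h, dt_self (hD _ h2).1]; exact zero_le_one
      · exact h.dt_nonneg hD hα) hf
  diag_fst f hf := closure_dirPairs_induction (p := fun f => (f.1, f.1) ∈ closure (dirPairs D))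
    (isClosed_closure.preimage (by fun_prop : Continuous fun f : ℂ × ℂ => (f.1, f.1)))
    (fun f hf => subset_closure ⟨hf.1, hf.1, Or.inl rfl⟩) hf
  diag_snd f hf := closure_dirPairs_induction (p := fun f => (f.2, f.2) ∈ closure (dirPairs D))
    (isClosed_closure.preimage (by fun_prop : Continuous fun f : ℂ × ℂ => (f.2, f.2)))
    (fun f hf => subset_closure ⟨hf.2.1, hf.2.1, Or.inl rfl⟩) hf
  neg_mem f hf := closure_dirPairs_induction (p := fun f => -f ∈ closure (dirPairs D))
    (isClosed_closure.preimage continuous_neg)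
    (fun f hf => subset_closure ⟨(hD _ hf.1).2, (hD _ hf.2.1).2,
      hf.2.2.imp (fun h => by simp [h]) fun h => h.neg hD⟩) hf
  gap f hf w hw := by
    have hw' : w ∈ closure D := by
      exact closure_dirPairs_induction (D := D) (p := fun f => f.1 ∈ closure D)
        (isClosed_closure.preimage continuous_fst) (fun f hf => subset_closure hf.1) hw
    have e1 : ∀ u, IsClosed {f : ℂ × ℂ | ¬ (0 < cr f.1 u ∧ 0 < cr u f.2)} := fun u =>
      ((isOpen_lt continuous_const (Continuous.cr continuous_fst continuous_const)).inter
        (isOpen_lt continuous_const (Continuous.cr continuous_const continuous_snd))).isClosed_compl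
    have e2 : IsClosed {u | ¬ (0 < cr f.1 u ∧ 0 < cr u f.2)} :=
      ((isOpen_lt continuous_const (Continuous.cr continuous_const continuous_id)).inter
        (isOpen_lt continuous_const (Continuous.cr continuous_id continuous_const))).isClosed_compl
    have hcl : ∀ u ∈ D, ¬ (0 < cr f.1 u ∧ 0 < cr u f.2) := fun u hu =>
      closure_dirPairs_induction (p := fun f => ¬ (0 < cr f.1 u ∧ 0 < cr u f.2))
        (e1 u) (by
        rintro f ⟨_, _, h | h⟩
        · rw [h, cr_comm u]; rintro ⟨_, _⟩; linarith
        · exact h.not_between hD hα hu) hf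
    exact closure_minimal (t := {u | ¬ (0 < cr f.1 u ∧ 0 < cr u f.2)}) hcl e2 hw'

lemma one_sub_le_dt_of_mem_closure (hD : IsDirectionSet D) {f : ℂ × ℂ}
    (hf : f ∈ closure (dirPairs D)) :
    1 - density D ^ 2 / 2 ≤ dt f.1 f.2 :=
  closure_dirPairs_induction (p := fun f => 1 - density D ^ 2 / 2 ≤ dt f.1 f.2)
    (isClosed_le continuous_const continuous_dt) (by
      rintro f ⟨_, h2, h | h⟩
      · rw [h, dt_self (hD _ h2).1]; nlinarith [sq_nonneg (density D)]
      · exact h.one_sub_le_dt hD) hf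

lemma pspan_neg_left {v w : ℂ} (h : 0 < cr v w) : pspan (-v) w = wedge (v, w) := by
  ext z
  constructor
  · rintro ⟨a, b, ha, hb, rfl⟩
    simp only [wedge, Set.mem_ofPred_eq, cr_add_right, cr_mul_right, cr_neg_right, cr_self,
      cr_comm w v]
    exact ⟨by nlinarith, by nlinarith⟩
  · rintro ⟨h1, h2⟩
    refine ⟨cr w z / cr v w, cr v z / cr v w, div_pos h2 h, div_pos h1 h, ?_⟩
    have hc : ((cr v w : ℝ) : ℂ) ≠ 0 := by exact_mod_cast h.ne'
    push_cast
    field_simp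
    apply Complex.ext <;> simp [cr] <;> ring

lemma leftHalfPlane_eq (v : ℂ) : leftHalfPlane v = wedge (v, v) := by
  ext z; simp [leftHalfPlane, wedge, cr, sub_eq_add_neg]

lemma rightHalfPlane_eq (v : ℂ) : rightHalfPlane v = wedge (-v, -v) := by
  ext z
  simp only [rightHalfPlane, wedge, Set.mem_ofPred_eq, cr_neg_left, and_self, neg_pos]
  simp [cr, sub_eq_add_neg]

lemma mem_ranges_iff (hD : IsDirectionSet D) (hα : density D ≤ Real.pi / 2) {Q : Set ℂ} :
    Q ∈ ranges D ↔ ∃ f ∈ dirPairs D, Q = wedge f := by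
  constructor
  · rintro (⟨v, hv, rfl | rfl⟩ | ⟨v, w, h, rfl | rfl⟩)
    · exact ⟨(v, v), ⟨hv, hv, Or.inl rfl⟩, leftHalfPlane_eq v⟩
    · exact ⟨(-v, -v), ⟨(hD v hv).2, (hD v hv).2, Or.inl rfl⟩, rightHalfPlane_eq v⟩
    · have h' := h.neg hD
      refine ⟨(-v, -w), ⟨h'.1, h'.2.1, Or.inr h'⟩, ?_⟩
      rw [← pspan_neg_left (h'.cr_pos hD hα), neg_neg]
    · exact ⟨(v, w), ⟨h.1, h.2.1, Or.inr h⟩, pspan_neg_left (h.cr_pos hD hα)⟩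
  · rintro ⟨⟨v, w⟩, ⟨h1, h2, h | h⟩, rfl⟩
    · simp only at h
      subst h
      exact Or.inl ⟨v, h1, Or.inl (leftHalfPlane_eq v).symm⟩
    · exact Or.inr ⟨v, w, h, Or.inr (pspan_neg_left (h.cr_pos hD hα)).symm⟩

lemma free_iff {S : Set ℂ} {f : ℂ × ℂ} {c : ℂ} :
    (fun z : ℂ => z + c) '' wedge f ∩ S = ∅ ↔ Free S f c := by
  rw [Set.eq_empty_iff_forall_notMem]
  constructor
  · intro h s hs hw
    exact h s ⟨⟨s - c, hw, by simp⟩, hs⟩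
  · rintro h _ ⟨⟨z, hz, rfl⟩, hs⟩
    exact h _ hs (by simpa using hz)

/-- The hull of a finite set is not changed by passing to the closure of the family of wedges. -/
lemma hull_eq_hullOf (hD : IsDirectionSet D) (hα : density D ≤ Real.pi / 2)
    {S : Set ℂ} (hS : S.Finite) :
    hull D S = hullOf (closure (dirPairs D)) S := by
  have hull_eq : hull D S = hullOf (dirPairs D) S := by
    ext x
    simp only [hull, translates, Set.mem_sdiff, Set.mem_univ, true_and, Set.mem_iUnion,
      Set.mem_ofPred_eq, not_exists, hullOf]
    constructor
    · intro h f hf c hc hx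
      exact h _ ⟨⟨_, (mem_ranges_iff hD hα).2 ⟨f, hf, rfl⟩, c, rfl⟩, free_iff.2 hc⟩
        ⟨x - c, hx, by simp⟩
    · rintro h I ⟨⟨Q, hQ, c, rfl⟩, he⟩ ⟨z, hz, hzx⟩
      obtain ⟨f, hf, rfl⟩ := (mem_ranges_iff hD hα).1 hQ
      refine h f hf c (free_iff.1 he) ?_
      rw [← hzx]; simpa using hz
  rw [hull_eq]
  refine Set.Subset.antisymm (fun x hx f hf c hc hw => ?_)
    fun x hx f hf => hx f (subset_closure hf)
  -- moving the apex halfway towards `x` makes all inequalities strict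
  set m : ℂ := c + (1 / 2 : ℝ) * (x - c) with hm
  have hxm : x - m = (1 / 2 : ℝ) * (x - c) := by rw [hm]; push_cast; ring
  have cont1 : ∀ z, Continuous fun g : ℂ × ℂ => cr g.1 z := fun z =>
    Continuous.cr continuous_fst continuous_const
  have cont2 : ∀ z, Continuous fun g : ℂ × ℂ => cr g.2 z := fun z =>
    Continuous.cr continuous_snd continuous_const
  have h1 : ∀ᶠ g in 𝓝 f, x - m ∈ wedge g := by
    have p1 : 0 < cr f.1 (x - m) := by rw [hxm, cr_mul_right]; linarith [hw.1]
    have p2 : 0 < cr f.2 (x - m) := by rw [hxm, cr_mul_right]; linarith [hw.2]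
    exact ((cont1 _).continuousAt.eventually (lt_mem_nhds p1)).and
      ((cont2 _).continuousAt.eventually (lt_mem_nhds p2))
  have h2 : ∀ᶠ g in 𝓝 f, ∀ s ∈ S, s - m ∉ wedge g := by
    refine (eventually_all_finite hS).2 fun s hs => ?_
    have hsm : s - m = (s - c) - (1 / 2 : ℝ) * (x - c) := by rw [hm]; push_cast; ring
    have hs' := hc s hs
    simp only [wedge, Set.mem_ofPred_eq, not_and_or, not_lt] at hs'
    rcases hs' with h | h
    · have p : cr f.1 (s - m) < 0 := by
        rw [hsm, cr_sub_right _ _ (_ * _), cr_mul_right]; linarith [hw.1]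
      filter_upwards [(cont1 _).continuousAt.eventually (gt_mem_nhds p)] with g hg hgw
      exact lt_asymm hg hgw.1
    · have p : cr f.2 (s - m) < 0 := by
        rw [hsm, cr_sub_right _ _ (_ * _), cr_mul_right]; linarith [hw.2]
      filter_upwards [(cont2 _).continuousAt.eventually (gt_mem_nhds p)] with g hg hgw
      exact lt_asymm hg hgw.2
  obtain ⟨g, hg, hg1, hg2⟩ := ((mem_closure_iff_frequently.1 hf).and_eventually (h1.and h2)).exists
  exact hx g hg m hg2 hg1

end DirHull

/-! ### Eight test sectors for the empty wedges with a given apex -/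

namespace DirHull

/-- The width parameter of the test box of a point at distance `h` from the unit circle. -/
noncomputable def width (α h : ℝ) : ℝ := min 1 (max (√h) α)

/-- The affine coordinates at `p` for which the square `(-1, 1) × (-1, 1)` is a box centred at `p`
with sides `h / width α h` tangentially and `h` radially, where `h = 1 - ‖p‖`. -/
noncomputable def stretch (α : ℝ) (p z : ℂ) : ℂ :=
  ((2 * width α (1 - ‖p‖) / (1 - ‖p‖) * cr (p / ‖p‖) (z - p) : ℝ) : ℂ) +
    ((2 / (1 - ‖p‖) * dt (p / ‖p‖) (z - p) : ℝ) : ℂ) * Complex.I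

/-- The sign encoded by a Boolean. -/
noncomputable def sgn (b : Bool) : ℝ := if b then 1 else -1

/-- The eight triangles into which the coordinate axes and the diagonals cut the square
`(-1, 1) × (-1, 1)`. -/
def sector (k : Bool × Bool × Bool) : Set ℂ :=
  {w | (|w.re| < 1 ∧ |w.im| < 1) ∧
    if k.2.2 then 0 < sgn k.1 * w.re ∧ sgn k.1 * w.re < sgn k.2.1 * w.im
    else 0 < sgn k.2.1 * w.im ∧ sgn k.2.1 * w.im < sgn k.1 * w.re}

lemma isOpen_sector (k : Bool × Bool × Bool) : IsOpen (sector k) := by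
  obtain ⟨a, b, c⟩ := k
  have h : IsOpen {w : ℂ | |w.re| < 1 ∧ |w.im| < 1} :=
    (isOpen_lt (f := fun w : ℂ => |w.re|) (g := fun _ => (1 : ℝ)) (by fun_prop)
      (by fun_prop)).inter (isOpen_lt (f := fun w : ℂ => |w.im|)
      (g := fun _ => (1 : ℝ)) (by fun_prop) (by fun_prop))
  cases c
  · exact h.inter ((isOpen_lt (f := fun _ : ℂ => (0 : ℝ)) (g := fun w => sgn b * w.im)
      (by fun_prop) (by fun_prop)).inter
      (isOpen_lt (f := fun w : ℂ => sgn b * w.im) (g := fun w => sgn a * w.re)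
      (by fun_prop) (by fun_prop)))
  · exact h.inter ((isOpen_lt (f := fun _ : ℂ => (0 : ℝ)) (g := fun w => sgn a * w.re)
      (by fun_prop) (by fun_prop)).inter
      (isOpen_lt (f := fun w : ℂ => sgn a * w.re) (g := fun w => sgn b * w.im)
      (by fun_prop) (by fun_prop)))

lemma sector_nonempty (k : Bool × Bool × Bool) : (sector k).Nonempty := by
  obtain ⟨a, b, c⟩ := k
  refine ⟨⟨sgn a * (if c then 1 / 3 else 1 / 2), sgn b * (if c then 1 / 2 else 1 / 3)⟩, ?_⟩
  cases a <;> cases b <;> cases c <;> norm_num [sector, sgn, abs_lt]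

lemma volume_sector_ne_top (k : Bool × Bool × Bool) : volume (sector k) ≠ ⊤ := by
  refine ne_top_of_le_ne_top (measure_closedBall_lt_top (μ := volume) (x := (0 : ℂ)) (r := 2)).ne
    (measure_mono fun w hw => ?_)
  rw [mem_closedBall_zero_iff]
  exact (Complex.norm_le_abs_re_add_abs_im w).trans (by linarith [hw.1.1, hw.1.2])

lemma exists_le_volume_sector : ∃ c : ℝ, 0 < c ∧ ∀ k, ENNReal.ofReal c ≤ volume (sector k) := by
  obtain ⟨k, hk⟩ := Finite.exists_min fun k => volume (sector k)
  have hpos := (isOpen_sector k).measure_pos volume (sector_nonempty k)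
  exact ⟨(volume (sector k)).toReal, ENNReal.toReal_pos hpos.ne' (volume_sector_ne_top k),
    fun l => by rw [ENNReal.ofReal_toReal (volume_sector_ne_top k)]; exact hk l⟩

/-- The intersection of two half-planes whose inner normals form no obtuse angle contains one of
the eight sectors. -/
lemma exists_sector_pos {a₁ b₁ a₂ b₂ : ℝ} (h₁ : a₁ ≠ 0 ∨ b₁ ≠ 0) (h₂ : a₂ ≠ 0 ∨ b₂ ≠ 0)
    (h : 0 ≤ a₁ * a₂ + b₁ * b₂) : ∃ k, ∀ w ∈ sector k,
      0 < a₁ * w.re + b₁ * w.im ∧ 0 < a₂ * w.re + b₂ * w.im := by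
  -- it suffices to check the two rays that bound the sector
  have upright : ∀ {x y : Bool} {a b : ℝ}, (a ≠ 0 ∨ b ≠ 0) → 0 ≤ sgn y * b →
      0 ≤ sgn x * a + sgn y * b → ∀ w ∈ sector (x, y, true), 0 < a * w.re + b * w.im := by
    intro x y a b hab hb hs w hw
    have hx : sgn x * sgn x = 1 := by cases x <;> norm_num [sgn]
    have hy : sgn y * sgn y = 1 := by cases y <;> norm_num [sgn]
    obtain ⟨-, hw1, hw2⟩ : (_ ∧ _) ∧ _ ∧ _ := by simpa [sector] using hw
    have e : a * w.re + b * w.im = (sgn x * a + sgn y * b) * (sgn x * w.re)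
        + sgn y * b * (sgn y * w.im - sgn x * w.re) := by
      linear_combination (-(a * w.re)) * hx - (b * w.im) * hy
    rw [e]
    rcases hb.lt_or_eq with hb' | hb'
    · exact add_pos_of_nonneg_of_pos (by positivity) (mul_pos hb' (by linarith))
    · rw [← hb'] at hs ⊢
      have : sgn x * a ≠ 0 := by
        have hb0 : b = 0 := by linear_combination (-b) * hy - sgn y * hb'
        have hx0 : sgn x ≠ 0 := by rintro h0; rw [h0] at hx; norm_num at hx
        exact mul_ne_zero hx0 (hab.resolve_right (by simpa using hb0))
      have h3 : 0 < sgn x * a + 0 := lt_of_le_of_ne hs (by simpa using this.symm)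
      have := mul_pos h3 hw1
      linarith
  have flat : ∀ {x y : Bool} {a b : ℝ}, (a ≠ 0 ∨ b ≠ 0) → 0 ≤ sgn x * a →
      0 ≤ sgn x * a + sgn y * b → ∀ w ∈ sector (x, y, false), 0 < a * w.re + b * w.im := by
    intro x y a b hab hb hs w hw
    have := upright (x := y) (y := x) hab.symm hb (by linarith) ⟨w.im, w.re⟩ (by
      simp only [sector, Set.mem_ofPred_eq] at hw ⊢
      simpa using ⟨⟨hw.1.2, hw.1.1⟩, hw.2⟩)
    simp only at this
    linarith
  have hsg : ∀ a : ℝ, ∃ x, sgn x * a = |a| := fun a => by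
    rcases le_total 0 a with h | h
    · exact ⟨true, by simp [sgn, abs_of_nonneg h]⟩
    · exact ⟨false, by simp [sgn, abs_of_nonpos h]⟩
  -- a sign that fits both of two numbers with nonnegative product
  have hsg2 : ∀ a b : ℝ, 0 ≤ a * b → ∃ x, 0 ≤ sgn x * a ∧ 0 ≤ sgn x * b := fun a b hab => by
    rcases mul_nonneg_iff.1 hab with h | h
    · exact ⟨true, by simpa [sgn] using h⟩
    · exact ⟨false, by simpa [sgn] using h⟩
  have sq1 : ∀ x, sgn x * sgn x = 1 := fun x => by cases x <;> norm_num [sgn]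
  rcases le_total 0 (a₁ * a₂) with ha | ha <;> rcases le_total 0 (b₁ * b₂) with hb | hb
  · obtain ⟨x, hx1, hx2⟩ := hsg2 _ _ ha
    obtain ⟨y, hy1, hy2⟩ := hsg2 _ _ hb
    exact ⟨(x, y, true), fun w hw => ⟨upright h₁ hy1 (by linarith) w hw,
      upright h₂ hy2 (by linarith) w hw⟩⟩
  · obtain ⟨x, hx1, hx2⟩ := hsg2 _ _ ha
    have hp : |b₁| * |b₂| ≤ (sgn x * a₁) * (sgn x * a₂) := by
      rw [← abs_mul, abs_of_nonpos hb]
      have : (sgn x * a₁) * (sgn x * a₂) = a₁ * a₂ := by linear_combination (a₁ * a₂) * sq1 x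
      linarith
    have hor : |b₁| ≤ sgn x * a₁ ∨ |b₂| ≤ sgn x * a₂ := by
      by_contra! hno
      nlinarith [mul_lt_mul'' hno.1 hno.2 hx1 hx2]
    rcases hor with hle | hle
    · obtain ⟨y, hy⟩ := hsg b₂
      refine ⟨(x, y, false), fun w hw => ⟨flat h₁ hx1 ?_ w hw, flat h₂ hx2 ?_ w hw⟩⟩
      · have : |sgn y * b₁| = |b₁| := by cases y <;> simp [sgn]
        linarith [neg_abs_le (sgn y * b₁)]
      · rw [hy]; positivity
    · obtain ⟨y, hy⟩ := hsg b₁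
      refine ⟨(x, y, false), fun w hw => ⟨flat h₁ hx1 ?_ w hw, flat h₂ hx2 ?_ w hw⟩⟩
      · rw [hy]; positivity
      · have : |sgn y * b₂| = |b₂| := by cases y <;> simp [sgn]
        linarith [neg_abs_le (sgn y * b₂)]
  · obtain ⟨y, hy1, hy2⟩ := hsg2 _ _ hb
    have hp : |a₁| * |a₂| ≤ (sgn y * b₁) * (sgn y * b₂) := by
      rw [← abs_mul, abs_of_nonpos ha]
      have : (sgn y * b₁) * (sgn y * b₂) = b₁ * b₂ := by linear_combination (b₁ * b₂) * sq1 y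
      linarith
    have hor : |a₁| ≤ sgn y * b₁ ∨ |a₂| ≤ sgn y * b₂ := by
      by_contra! hno
      nlinarith [mul_lt_mul'' hno.1 hno.2 hy1 hy2]
    rcases hor with hle | hle
    · obtain ⟨x, hx⟩ := hsg a₂
      refine ⟨(x, y, true), fun w hw => ⟨upright h₁ hy1 ?_ w hw, upright h₂ hy2 ?_ w hw⟩⟩
      · have : |sgn x * a₁| = |a₁| := by cases x <;> simp [sgn]
        linarith [neg_abs_le (sgn x * a₁)]
      · rw [hx]; positivity
    · obtain ⟨x, hx⟩ := hsg a₁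
      refine ⟨(x, y, true), fun w hw => ⟨upright h₁ hy1 ?_ w hw, upright h₂ hy2 ?_ w hw⟩⟩
      · rw [hx]; positivity
      · have : |sgn x * a₂| = |a₂| := by cases x <;> simp [sgn]
        linarith [neg_abs_le (sgn x * a₂)]
  · have h0 : a₁ * a₂ = 0 := by linarith
    have h0' : b₁ * b₂ = 0 := by linarith
    obtain ⟨x, hx1, hx2⟩ := hsg2 a₁ a₂ h0.ge
    obtain ⟨y, hy1, hy2⟩ := hsg2 b₁ b₂ h0'.ge
    exact ⟨(x, y, true), fun w hw => ⟨upright h₁ hy1 (by linarith) w hw,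
      upright h₂ hy2 (by linarith) w hw⟩⟩

lemma width_pos {α h : ℝ} (hh : 0 < h) : 0 < width α h :=
  lt_min one_pos (lt_max_of_lt_left (Real.sqrt_pos.2 hh))

lemma norm_div_norm {p : ℂ} (hp : p ≠ 0) : ‖p / ‖p‖‖ = 1 := by
  rw [norm_div, Complex.norm_real, norm_norm, div_self (norm_ne_zero_iff.2 hp)]

@[simp] lemma stretch_re (α : ℝ) (p z : ℂ) : (stretch α p z).re =
    2 * width α (1 - ‖p‖) / (1 - ‖p‖) * cr (p / ‖p‖) (z - p) := by
  simp only [stretch, Complex.add_re, Complex.ofReal_re, Complex.re_ofReal_mul, Complex.I_re,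
    mul_zero, add_zero]

@[simp] lemma stretch_im (α : ℝ) (p z : ℂ) : (stretch α p z).im =
    2 / (1 - ‖p‖) * dt (p / ‖p‖) (z - p) := by
  simp only [stretch, Complex.add_im, Complex.ofReal_im, Complex.im_ofReal_mul, Complex.I_im,
    mul_one, zero_add]

/-- In the stretched coordinates at its apex `p`, the wedge of a pair at angle at most `α` and at
most `π / 2` still has an angle of at least `π / 2`, so it contains one of the eight sectors. -/
lemma exists_sector_subset_wedge {α : ℝ} (hα : 0 ≤ α) {p : ℂ} (hp : p ≠ 0) (hp1 : ‖p‖ < 1)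
    {f : ℂ × ℂ} (h₁ : ‖f.1‖ = 1) (h₂ : ‖f.2‖ = 1) (hdt : 0 ≤ dt f.1 f.2)
    (hdt' : 1 - α ^ 2 / 2 ≤ dt f.1 f.2) :
    ∃ k, ∀ z, stretch α p z ∈ sector k → z - p ∈ wedge f := by
  set u : ℂ := p / ‖p‖ with hu
  have hun : ‖u‖ = 1 := norm_div_norm hp
  set h := 1 - ‖p‖ with hh
  have hpos : 0 < h := by rw [hh]; linarith
  set s := width α h with hs
  have spos : 0 < s := width_pos hpos
  have q1 := cr_sq_add_dt_sq h₁ hun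
  have q2 := cr_sq_add_dt_sq h₂ hun
  have hsum : dt f.1 u * dt f.2 u + cr f.1 u * cr f.2 u = dt f.1 f.2 := by
    have e : dt f.1 u * dt f.2 u + cr f.1 u * cr f.2 u = dt u u * dt f.1 f.2 := by
      simp only [cr, dt]; ring
    rw [e, dt_self hun, one_mul]
  have key : 0 ≤ dt f.1 u * dt f.2 u + s ^ 2 * (cr f.1 u * cr f.2 u) := by
    rcases le_or_gt 1 s with h1 | h1
    · have : s = 1 := le_antisymm (min_le_left _ _) h1
      rw [this]; linarith
    · have hsα : α ≤ s := by
        rw [hs, width] at h1 ⊢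
        rcases min_lt_iff.1 h1 with h | h
        · exact absurd h (lt_irrefl _)
        · rw [min_eq_right h.le]; exact le_max_right _ _
      have hle : 1 - s ^ 2 / 2 ≤ dt f.1 f.2 := by
        have := pow_le_pow_left₀ hα hsα 2
        linarith
      have hlow : -(s ^ 2 / 4) ≤ dt f.1 u * dt f.2 u := by
        nlinarith [sq_nonneg (dt f.1 u + dt f.2 u), sq_nonneg (cr f.1 u - cr f.2 u)]
      have s1 : s ^ 2 ≤ 1 := by nlinarith
      have e : dt f.1 u * dt f.2 u + s ^ 2 * (cr f.1 u * cr f.2 u)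
          = s ^ 2 * dt f.1 f.2 + (1 - s ^ 2) * (dt f.1 u * dt f.2 u) := by
        rw [← hsum]; ring
      rw [e]
      have t1 := mul_le_mul_of_nonneg_left hle (sq_nonneg s)
      have t2 := mul_le_mul_of_nonneg_left hlow (sub_nonneg.2 s1)
      nlinarith [sq_nonneg s]
  have ne : ∀ a : ℂ, cr a u ^ 2 + dt a u ^ 2 = 1 → dt a u / s ≠ 0 ∨ cr a u ≠ 0 := by
    intro a ha
    by_contra! hno
    have := (div_eq_zero_iff.1 hno.1).resolve_right spos.ne'
    rw [this, hno.2] at ha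
    norm_num at ha
  obtain ⟨k, hk⟩ := exists_sector_pos (ne _ q1) (ne _ q2) (by
    have e : dt f.1 u / s * (dt f.2 u / s) + cr f.1 u * cr f.2 u
        = (dt f.1 u * dt f.2 u + s ^ 2 * (cr f.1 u * cr f.2 u)) / s ^ 2 := by field_simp
    rw [e]; positivity)
  refine ⟨k, fun z hz => ?_⟩
  have := hk _ hz
  have e : ∀ a : ℂ, cr a (z - p) = h / 2 * (dt a u / s * (stretch α p z).re
      + cr a u * (stretch α p z).im) := by
    intro a
    rw [cr_eq_of_unit hun a, stretch_re, stretch_im, ← hu, ← hh, ← hs]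
    field_simp
    ring
  simp only [wedge, Set.mem_ofPred_eq, e]
  exact ⟨mul_pos (by linarith) this.1, mul_pos (by linarith) this.2⟩

/-- The test box of `p` lies in the unit disk, because `h ≤ (width α h) ^ 2`. -/
lemma mem_closedBall_of_stretch_mem {α : ℝ} {p z : ℂ} (hp : p ≠ 0) (hp1 : ‖p‖ < 1)
    {k : Bool × Bool × Bool} (hz : stretch α p z ∈ sector k) : z ∈ Metric.closedBall (0 : ℂ) 1 := by
  set u : ℂ := p / ‖p‖ with hu
  have hun : ‖u‖ = 1 := norm_div_norm hp
  set h := 1 - ‖p‖ with hh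
  have hpos : 0 < h := by rw [hh]; linarith
  have hle1 : h ≤ 1 := by rw [hh]; linarith [norm_nonneg p]
  set s := width α h with hs
  have spos : 0 < s := width_pos hpos
  have hsh : h ≤ s ^ 2 := by
    have : √h ≤ s := le_min (Real.sqrt_le_one.2 hle1) (le_max_left _ _)
    calc h = √h ^ 2 := (Real.sq_sqrt hpos.le).symm
      _ ≤ s ^ 2 := pow_le_pow_left₀ (Real.sqrt_nonneg _) this 2
  obtain ⟨h1, h2⟩ := hz.1
  rw [stretch_re, ← hu, ← hh, ← hs] at h1
  rw [stretch_im, ← hu, ← hh] at h2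
  set X := 2 * s / h * cr u (z - p)
  set Y := 2 / h * dt u (z - p)
  have eX : cr u (z - p) = X * h / (2 * s) := by simp only [X]; field_simp
  have eY : dt u (z - p) = Y * h / 2 := by simp only [Y]; field_simp
  have hn : ‖z‖ ^ 2 = cr u (z - p) ^ 2 + (‖p‖ + dt u (z - p)) ^ 2 := by
    rw [← cr_sq_add_dt_sq_eq_norm_sq hun z]
    have hpu : p = (‖p‖ : ℝ) * u := by
      rw [hu]; field_simp [show ((‖p‖ : ℝ) : ℂ) ≠ 0 by exact_mod_cast norm_ne_zero_iff.2 hp]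
    have e1 : cr u z = cr u (z - p) := by
      rw [cr_sub_right]; conv_rhs => rw [hpu]
      rw [cr_mul_right, cr_self]; ring
    have e2 : dt u z = ‖p‖ + dt u (z - p) := by
      have : dt u (z - p) = dt u z - ‖p‖ * dt u u := by
        conv_lhs => rw [hpu]
        simp [dt]; ring
      rw [this, dt_self hun]; ring
    rw [e1, e2]
  rw [mem_closedBall_zero_iff]
  refine (sq_le_one_iff₀ (norm_nonneg _)).1 ?_
  rw [hn, eX, eY, show ‖p‖ = 1 - h by rw [hh]; ring]
  have b1 : (X * h / (2 * s)) ^ 2 ≤ h / 4 := by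
    have hX : X ^ 2 ≤ 1 := ((sq_lt_one_iff_abs_lt_one _).2 h1).le
    rw [div_pow, div_le_iff₀ (by positivity)]
    nlinarith [mul_le_mul_of_nonneg_right hX (sq_nonneg h), mul_le_mul_of_nonneg_left hsh hpos.le]
  have b2 : (1 - h + Y * h / 2) ^ 2 ≤ (1 - h / 2) ^ 2 := by
    obtain ⟨h3, h4⟩ := abs_lt.1 h2
    refine sq_le_sq' ?_ ?_ <;> nlinarith
  nlinarith

/-! ### The probability that a test sector is empty -/

lemma volume_linear_preimage {a b c d : ℝ} (h : a * d - b * c ≠ 0) (A : Set ℂ) :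
    volume {z : ℂ | (⟨a * z.re + b * z.im, c * z.re + d * z.im⟩ : ℂ) ∈ A}
      = ENNReal.ofReal |(a * d - b * c)⁻¹| * volume A := by
  set L : ℂ →ₗ[ℝ] ℂ := Matrix.toLin Complex.basisOneI Complex.basisOneI !![a, b; c, d] with hL
  have hdet : LinearMap.det L = a * d - b * c := by
    rw [hL, LinearMap.det_toLin, Matrix.det_fin_two_of]
  have happ : ∀ z, L z = (⟨a * z.re + b * z.im, c * z.re + d * z.im⟩ : ℂ) := by
    intro z
    rw [hL, Matrix.toLin_apply]
    apply Complex.ext <;> simp [Matrix.mulVec, dotProduct, Fin.sum_univ_two]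
  have := Measure.addHaar_preimage_linearMap volume (f := L) (by rw [hdet]; exact h) A
  rw [hdet] at this
  rw [← this]
  congr 1
  ext z
  simp [happ]

lemma volume_stretch_preimage {α : ℝ} {p : ℂ} (hp : p ≠ 0) (hp1 : ‖p‖ < 1) (A : Set ℂ) :
    volume {z | stretch α p z ∈ A}
      = ENNReal.ofReal ((1 - ‖p‖) ^ 2 / (4 * width α (1 - ‖p‖))) * volume A := by
  set u : ℂ := p / ‖p‖ with hu
  have hun : ‖u‖ = 1 := norm_div_norm hp
  set h := 1 - ‖p‖ with hh
  have hpos : 0 < h := by rw [hh]; linarith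
  set s := width α h with hs
  have spos : 0 < s := width_pos hpos
  have hd := dt_self hun
  simp only [dt] at hd
  have hdet : (-(2 * s / h * u.im)) * (2 / h * u.im) - (2 * s / h * u.re) * (2 / h * u.re)
      = -(4 * s / h ^ 2) := by
    field_simp
    linear_combination (-4) * hd
  have := volume_linear_preimage (a := -(2 * s / h * u.im)) (b := 2 * s / h * u.re)
    (c := 2 / h * u.re) (d := 2 / h * u.im)
    (by rw [hdet]; exact (neg_neg_of_pos (by positivity)).ne) A
  rw [hdet, inv_neg, abs_neg, inv_div, abs_of_pos (by positivity)] at this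
  rw [← this, ← measure_preimage_add_right volume p]
  congr 1
  ext z
  simp only [Set.mem_preimage, Set.mem_ofPred_eq]
  have e : stretch α p (z + p) = (⟨-(2 * s / h * u.im) * z.re + 2 * s / h * u.re * z.im,
      2 / h * u.re * z.re + 2 / h * u.im * z.im⟩ : ℂ) := by
    apply Complex.ext
    · rw [stretch_re, ← hu, ← hh, ← hs, cr, add_sub_cancel_right]; ring
    · rw [stretch_im, ← hu, ← hh, dt, add_sub_cancel_right]; ring
  rw [e]

lemma measurable_stretch (α : ℝ) : Measurable fun q : ℂ × ℂ => stretch α q.1 q.2 := by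
  unfold stretch width cr dt
  fun_prop

/-- The uniform distribution on the unit disk. -/
noncomputable abbrev diskLaw : Measure ℂ := (volume : Measure ℂ)[|Metric.closedBall (0 : ℂ) 1]

instance : IsProbabilityMeasure diskLaw :=
  cond_isProbabilityMeasure_of_finite
    (Metric.measure_closedBall_pos volume (0 : ℂ) one_pos).ne'
    (measure_closedBall_lt_top (μ := volume) (x := (0 : ℂ))).ne

lemma diskLaw_eq_smul : diskLaw
    = (ENNReal.ofReal Real.pi)⁻¹ • volume.restrict (Metric.closedBall (0 : ℂ) 1) := by
  have : volume (Metric.closedBall (0 : ℂ) 1) = ENNReal.ofReal Real.pi := by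
    rw [Complex.volume_closedBall, ENNReal.ofReal_one, one_pow, one_mul, ← NNReal.coe_real_pi,
      ENNReal.ofReal_coe_nnreal]
  rw [diskLaw, ProbabilityTheory.cond, this]

lemma ae_diskLaw : ∀ᵐ p ∂diskLaw, p ≠ 0 ∧ ‖p‖ < 1 := by
  rw [diskLaw_eq_smul]
  refine Measure.ae_smul_measure ?_ _
  rw [ae_restrict_iff' measurableSet_closedBall]
  have h1 : ∀ᵐ p : ℂ, p ≠ 0 := by simp [ae_iff]
  have h2 : ∀ᵐ p : ℂ, p ∉ Metric.sphere (0 : ℂ) 1 :=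
    measure_eq_zero_iff_ae_notMem.1 (Measure.addHaar_sphere volume 0 1)
  filter_upwards [h1, h2] with p hp hp' hb
  rw [mem_closedBall_zero_iff] at hb
  rw [mem_sphere_zero_iff_norm] at hp'
  exact ⟨hp, lt_of_le_of_ne hb hp'⟩

/-- A random point misses a given test sector of `p` with probability at most `1 - a ≤ exp (-a)`,
for a lower bound `a` of the relative area of the sector. -/
lemma diskLaw_sector_compl_le {c : ℝ} (hc : 0 < c)
    (hcs : ∀ k, ENNReal.ofReal c ≤ volume (sector k)) (α : ℝ) {p : ℂ} (hp : p ≠ 0) (hp1 : ‖p‖ < 1)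
    (k : Bool × Bool × Bool) :
    diskLaw {z | stretch α p z ∉ sector k} ≤ ENNReal.ofReal
      (Real.exp (-(c / (4 * Real.pi) * ((1 - ‖p‖) ^ 2 / width α (1 - ‖p‖))))) := by
  set h := 1 - ‖p‖ with hh
  have hpos : 0 < h := by rw [hh]; linarith
  set s := width α h with hs
  have spos : 0 < s := width_pos hpos
  have hmeas : MeasurableSet {z | stretch α p z ∈ sector k} :=
    ((measurable_stretch α).comp measurable_prodMk_left) (isOpen_sector k).measurableSet
  have hsub : Metric.closedBall (0 : ℂ) 1 ∩ {z | stretch α p z ∈ sector k}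
      = {z | stretch α p z ∈ sector k} :=
    Set.inter_eq_right.2 fun z hz => mem_closedBall_of_stretch_mem hp hp1 hz
  have hlow : ENNReal.ofReal (c / (4 * Real.pi) * (h ^ 2 / s))
      ≤ diskLaw {z | stretch α p z ∈ sector k} := by
    rw [diskLaw_eq_smul, Measure.smul_apply, Measure.restrict_apply hmeas, Set.inter_comm, hsub,
      volume_stretch_preimage hp hp1, smul_eq_mul, ← hh, ← hs,
      ← ENNReal.ofReal_inv_of_pos Real.pi_pos]
    calc ENNReal.ofReal (c / (4 * Real.pi) * (h ^ 2 / s))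
        = ENNReal.ofReal Real.pi⁻¹ * (ENNReal.ofReal (h ^ 2 / (4 * s)) * ENNReal.ofReal c) := by
          rw [← ENNReal.ofReal_mul (by positivity), ← ENNReal.ofReal_mul (by positivity)]
          congr 1
          field_simp
      _ ≤ _ := by gcongr; exact hcs k
  have hcompl : {z | stretch α p z ∉ sector k} = {z | stretch α p z ∈ sector k}ᶜ := rfl
  rw [hcompl, prob_compl_eq_one_sub hmeas]
  refine (tsub_le_tsub_left hlow 1).trans ?_
  rw [← ENNReal.ofReal_one, ← ENNReal.ofReal_sub _ (by positivity)]
  exact ENNReal.ofReal_le_ofReal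
    (by linarith [Real.add_one_le_exp (-(c / (4 * Real.pi) * (h ^ 2 / s)))])

/-- The samples of `m + 1` points for which the test sector `k` of the point with index `i` contains
none of the other points. -/
def emptySector (α : ℝ) {m : ℕ} (i : Fin (m + 1)) (k : Bool × Bool × Bool) :
    Set (Fin (m + 1) → ℂ) :=
  {N | ∀ j : Fin m, stretch α (N i) (N (i.succAbove j)) ∉ sector k}

lemma measurableSet_stretch_notMem (α : ℝ) {X : Type*} [MeasurableSpace X] {f g : X → ℂ}
    (hf : Measurable f) (hg : Measurable g) (k : Bool × Bool × Bool) :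
    MeasurableSet {x | stretch α (f x) (g x) ∉ sector k} :=
  (((measurable_stretch α).comp (hf.prodMk hg)) (isOpen_sector k).measurableSet).compl

lemma measurableSet_emptySector (α : ℝ) {m : ℕ} (i : Fin (m + 1)) (k : Bool × Bool × Bool) :
    MeasurableSet (emptySector α i k) := by
  rw [emptySector, Set.ofPred_forall]
  exact MeasurableSet.iInter fun j =>
    measurableSet_stretch_notMem α (measurable_pi_apply _) (measurable_pi_apply _) k

/-- Given the point with index `i`, the other points are independent. -/
lemma uniformSample_emptySector_le {c : ℝ} (hc : 0 < c)
    (hcs : ∀ k, ENNReal.ofReal c ≤ volume (sector k)) (α : ℝ) {m : ℕ} (i : Fin (m + 1))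
    (k : Bool × Bool × Bool) :
    uniformSample (m + 1) (emptySector α i k) ≤ ∫⁻ p, ENNReal.ofReal
      (Real.exp (-(m * (c / (4 * Real.pi)) * ((1 - ‖p‖) ^ 2 / width α (1 - ‖p‖))))) ∂diskLaw := by
  set B : Set (ℂ × (Fin m → ℂ)) := {q | ∀ j, stretch α q.1 (q.2 j) ∉ sector k} with hB
  have hBm : MeasurableSet B := by
    rw [hB, Set.ofPred_forall]
    exact MeasurableSet.iInter fun j => measurableSet_stretch_notMem α measurable_fst
      ((measurable_pi_apply _).comp measurable_snd) k
  have hmp := measurePreserving_piFinSuccAbove (fun _ : Fin (m + 1) => diskLaw) i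
  have hpre : emptySector α i k = MeasurableEquiv.piFinSuccAbove (fun _ => ℂ) i ⁻¹' B := by
    ext N; rfl
  rw [hpre, uniformSample, hmp.measure_preimage hBm.nullMeasurableSet, Measure.prod_apply hBm]
  refine lintegral_mono_ae ?_
  filter_upwards [ae_diskLaw] with p hp
  have hset : Prod.mk p ⁻¹' B =
      Set.pi Set.univ fun _ : Fin m => {z | stretch α p z ∉ sector k} := by
    ext q; simp [hB]
  rw [hset, Measure.pi_pi, Finset.prod_const, Finset.card_univ, Fintype.card_fin]
  refine (pow_le_pow_left' (diskLaw_sector_compl_le hc hcs α hp.1 hp.2 k) m).trans_eq ?_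
  rw [← ENNReal.ofReal_pow (Real.exp_pos _).le, ← Real.exp_nat_mul]
  congr 2
  ring

end DirHull

/-! ### The expected number of exposed points -/

namespace DirHull

open Set

/-- Integration in polar coordinates, where the density `2 r` of the radius is at most `2`. -/
lemma lintegral_norm_diskLaw_le {φ : ℝ → ℝ≥0∞} (hφ : Measurable φ) :
    ∫⁻ p, φ (1 - ‖p‖) ∂diskLaw ≤ 2 * ∫⁻ h in Ioo 0 1, φ h := by
  have hπ := Real.pi_pos
  have h1 : ∫⁻ p in Metric.closedBall (0 : ℂ) 1, φ (1 - ‖p‖)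
      = ∫⁻ p : ℂ, (Iic 1).indicator (fun r => φ (1 - r)) ‖p‖ := by
    rw [← lintegral_indicator measurableSet_closedBall]
    refine lintegral_congr fun p => ?_
    simp [indicator]
  have hψ : Measurable fun r : ℝ => ENNReal.ofReal r * (Iic 1).indicator (fun r => φ (1 - r)) r :=
    ENNReal.measurable_ofReal.mul ((hφ.comp (by fun_prop)).indicator measurableSet_Iic)
  have h2 : ∫⁻ p : ℂ, (Iic 1).indicator (fun r => φ (1 - r)) ‖p‖
      = ENNReal.ofReal (2 * Real.pi) *
        ∫⁻ r in Ioi (0 : ℝ), ENNReal.ofReal r * (Iic 1).indicator (fun r => φ (1 - r)) r := by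
    rw [← Complex.lintegral_comp_polarCoord_symm, polarCoord_target, Measure.volume_eq_prod,
      ← Measure.prod_restrict]
    have hcongr : ∫⁻ q, ENNReal.ofReal q.1 • (Iic 1).indicator (fun r => φ (1 - r))
          ‖Complex.polarCoord.symm q‖
          ∂((volume.restrict (Ioi (0 : ℝ))).prod (volume.restrict (Ioo (-Real.pi) Real.pi)))
        = ∫⁻ q, ENNReal.ofReal q.1 * (Iic 1).indicator (fun r => φ (1 - r)) q.1
          ∂((volume.restrict (Ioi (0 : ℝ))).prod (volume.restrict (Ioo (-Real.pi) Real.pi))) := by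
      refine lintegral_congr_ae ?_
      rw [Measure.prod_restrict]
      filter_upwards [ae_restrict_mem (measurableSet_Ioi.prod measurableSet_Ioo)] with q hq
      rw [Complex.norm_polarCoord_symm, abs_of_pos hq.1, smul_eq_mul]
    have hψ' : Measurable fun q : ℝ × ℝ =>
        ENNReal.ofReal q.1 * (Iic 1).indicator (fun r => φ (1 - r)) q.1 := hψ.comp measurable_fst
    rw [hcongr, lintegral_prod _ hψ'.aemeasurable]
    simp only [lintegral_const, Measure.restrict_apply_univ, Real.volume_Ioo]
    rw [lintegral_mul_const _ hψ, mul_comm]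
    congr 2
    ring
  have h3 : ∫⁻ r in Ioi (0 : ℝ), ENNReal.ofReal r * (Iic 1).indicator (fun r => φ (1 - r)) r
      ≤ ∫⁻ h in Ioo 0 1, φ h := by
    calc _ ≤ ∫⁻ r : ℝ, (Ico 0 1).indicator φ (1 - r) := by
          rw [← lintegral_indicator measurableSet_Ioi]
          refine lintegral_mono fun r => ?_
          by_cases hr0 : 0 < r
          · by_cases hr1 : r ≤ 1
            · have hmem : 1 - r ∈ Ico (0 : ℝ) 1 := ⟨by linarith, by linarith⟩
              simp only [indicator, mem_Ioi, hr0, mem_Iic, hr1, if_true, hmem]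
              calc ENNReal.ofReal r * φ (1 - r) ≤ 1 * φ (1 - r) := by
                    gcongr; exact ENNReal.ofReal_le_one.2 hr1
                _ = _ := one_mul _
            · simp [indicator, hr1]
          · simp [indicator, hr0]
      _ = ∫⁻ r : ℝ, (Ico 0 1).indicator φ r := lintegral_sub_left_eq_self _ 1
      _ = ∫⁻ h in Ico 0 1, φ h := lintegral_indicator measurableSet_Ico _
      _ = _ := by rw [restrict_Ioo_eq_restrict_Ico]
  rw [diskLaw_eq_smul, lintegral_smul_measure, h1, h2, smul_eq_mul, ← mul_assoc,
    ← ENNReal.ofReal_inv_of_pos hπ, ← ENNReal.ofReal_mul (by positivity),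
    show Real.pi⁻¹ * (2 * Real.pi) = 2 by field_simp]
  simpa using mul_le_mul_right h3 2

lemma lintegral_exp_rpow_le {a b : ℝ} (ha : 0 < a) (hb : 0 < b) :
    ∫⁻ h in Ioo (0 : ℝ) 1, ENNReal.ofReal (Real.exp (-b * h ^ a))
      ≤ ENNReal.ofReal (b ^ (-1 / a) * Real.Gamma (1 / a + 1)) := by
  rw [← integral_exp_neg_mul_rpow ha hb, ofReal_integral_eq_lintegral_ofReal]
  · exact lintegral_mono_set Ioo_subset_Ioi_self
  · simpa [IntegrableOn] using integrableOn_rpow_mul_exp_neg_mul_rpow (s := 0) (by norm_num) ha hb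
  · exact Filter.Eventually.of_forall fun _ => (Real.exp_pos _).le

/-- The first summand comes from the points whose distance `h` to the unit circle satisfies
`α ≤ √h`, for which the curvature of the disk dominates; the second one from the others. -/
lemma lintegral_exp_width_le {α b : ℝ} (hα : 0 ≤ α) (hb : 0 < b) :
    ∫⁻ h in Ioo (0 : ℝ) 1, ENNReal.ofReal (Real.exp (-(b * (h ^ 2 / width α h))))
      ≤ ENNReal.ofReal
        (b ^ (-(2 / 3) : ℝ) * Real.Gamma (5 / 3) + √(α / b) * Real.Gamma (3 / 2)) := by
  have g1 := Real.Gamma_pos_of_pos (s := 5 / 3) (by norm_num)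
  have g2 := Real.Gamma_pos_of_pos (s := 3 / 2) (by norm_num)
  have hcurv : ∀ h ∈ Ioo (0 : ℝ) 1, α ≤ √h →
      Real.exp (-(b * (h ^ 2 / width α h))) ≤ Real.exp (-b * h ^ (3 / 2 : ℝ)) := by
    intro h hh hle
    have hw : width α h = √h := by
      rw [width, max_eq_left hle, min_eq_right (Real.sqrt_le_one.2 hh.2.le)]
    have hs := Real.sqrt_pos.2 hh.1
    have e : h ^ 2 / √h = h ^ (3 / 2 : ℝ) := by
      rw [Real.sqrt_eq_rpow, ← Real.rpow_natCast, ← Real.rpow_sub hh.1]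
      norm_num
    rw [hw, e, neg_mul]
  have hΓ1 : ∫⁻ h in Ioo (0 : ℝ) 1, ENNReal.ofReal (Real.exp (-b * h ^ (3 / 2 : ℝ)))
      ≤ ENNReal.ofReal (b ^ (-(2 / 3) : ℝ) * Real.Gamma (5 / 3)) := by
    refine (lintegral_exp_rpow_le (by norm_num) hb).trans_eq ?_
    norm_num
  rcases hα.lt_or_eq with hα | hα
  · have hflat : ∀ h ∈ Ioo (0 : ℝ) 1, √h ≤ α →
        Real.exp (-(b * (h ^ 2 / width α h))) ≤ Real.exp (-(b / α) * h ^ (2 : ℝ)) := by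
      intro h hh hle
      have hw : width α h ≤ α := by
        rw [width, max_eq_right hle]; exact min_le_right _ _
      rw [Real.rpow_two, Real.exp_le_exp, neg_mul, neg_le_neg_iff, div_mul_eq_mul_div,
        mul_div_assoc]
      have := width_pos (α := α) hh.1
      gcongr
    have hΓ2 : ∫⁻ h in Ioo (0 : ℝ) 1, ENNReal.ofReal (Real.exp (-(b / α) * h ^ (2 : ℝ)))
        ≤ ENNReal.ofReal (√(α / b) * Real.Gamma (3 / 2)) := by
      refine (lintegral_exp_rpow_le (by norm_num) (div_pos hb hα)).trans_eq ?_
      rw [Real.sqrt_eq_rpow, neg_div, Real.rpow_neg (by positivity),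
        ← Real.inv_rpow (by positivity), inv_div]
      norm_num
    rw [ENNReal.ofReal_add (by positivity) (by positivity)]
    refine le_trans ?_ (add_le_add hΓ1 hΓ2)
    rw [← lintegral_add_left (by fun_prop)]
    refine setLIntegral_mono (by fun_prop) fun h hh => ?_
    rcases le_total α √h with hle | hle
    · exact (ENNReal.ofReal_le_ofReal (hcurv h hh hle)).trans le_self_add
    · exact (ENNReal.ofReal_le_ofReal (hflat h hh hle)).trans le_add_self
  · rw [← hα, zero_div, Real.sqrt_zero, zero_mul, add_zero]
    refine le_trans ?_ hΓ1
    exact setLIntegral_mono (by fun_prop) fun h hh => ENNReal.ofReal_le_ofReal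
      (by rw [hα]; exact hcurv h hh (by rw [← hα]; exact Real.sqrt_nonneg _))

lemma uniformSample_emptySector_le_ofReal {c : ℝ} (hc : 0 < c)
    (hcs : ∀ k, ENNReal.ofReal c ≤ volume (sector k)) {α : ℝ} (hα : 0 ≤ α) {m : ℕ} (hm : 0 < m)
    (i : Fin (m + 1)) (k : Bool × Bool × Bool) :
    uniformSample (m + 1) (emptySector α i k) ≤ ENNReal.ofReal
      (2 * ((m * (c / (4 * Real.pi))) ^ (-(2 / 3) : ℝ) * Real.Gamma (5 / 3)
        + √(α / (m * (c / (4 * Real.pi)))) * Real.Gamma (3 / 2))) := by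
  have hm' : (0 : ℝ) < m := by exact_mod_cast hm
  have hπ := Real.pi_pos
  refine (uniformSample_emptySector_le hc hcs α i k).trans ?_
  refine (lintegral_norm_diskLaw_le (φ := fun h => ENNReal.ofReal
    (Real.exp (-(m * (c / (4 * Real.pi)) * (h ^ 2 / width α h))))) ?_).trans ?_
  · unfold width; fun_prop
  · rw [ENNReal.ofReal_mul zero_le_two, ENNReal.ofReal_ofNat]
    gcongr
    exact lintegral_exp_width_le hα (by positivity)

/-- With probability one, the number of vertices of the hull is at most seven times the number of
pairs of an index of a point and an empty test sector of this point. -/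
lemma ae_encard_vertices_le {D : Set ℂ} (hD : IsDirectionSet D) (hα : density D ≤ Real.pi / 2)
    (m : ℕ) : ∀ᵐ N ∂uniformSample (m + 1), ((vertices (hull D (range N))).encard : ℝ≥0∞)
      ≤ 7 * ∑ i, ∑ k, (emptySector (density D) i k).indicator 1 N := by
  classical
  have hae : ∀ᵐ N ∂uniformSample (m + 1), ∀ i, N i ≠ 0 ∧ ‖N i‖ < 1 :=
    ae_all_iff.2 fun i =>
      (Measure.quasiMeasurePreserving_eval (fun _ : Fin (m + 1) => diskLaw) i).ae
      ae_diskLaw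
  filter_upwards [hae] with N hN
  have hF := isGapFamily_closure hD hα
  rw [hull_eq_hullOf hD hα (finite_range N)]
  set F := closure (dirPairs D)
  have h1 := hF.encard_vertices_le (finite_range N)
  set I : Finset (Fin (m + 1)) := {i | ∃ k, N ∈ emptySector (density D) i k} with hI
  have hsub : {p ∈ range N | ∃ f ∈ F, Free (range N) f p} ⊆ N '' I := by
    rintro _ ⟨⟨i, rfl⟩, f, hf, hfree⟩
    refine ⟨i, ?_, rfl⟩
    obtain ⟨k, hk⟩ := exists_sector_subset_wedge (density_nonneg D) (hN i).1 (hN i).2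
      (hF.norm_fst f hf) (hF.norm_snd f hf) (hF.dt_nonneg f hf) (one_sub_le_dt_of_mem_closure hD hf)
    simp only [hI, Finset.coe_filter, Finset.mem_univ, true_and, mem_ofPred_eq]
    exact ⟨k, fun j hj => hfree _ (mem_range_self _) (hk _ hj)⟩
  have h2 : {p ∈ range N | ∃ f ∈ F, Free (range N) f p}.encard ≤ (I.card : ℕ∞) :=
    (encard_le_encard hsub).trans ((encard_image_le _ _).trans (by simp))
  have h3 : (vertices (hullOf F (range N))).encard ≤ ((7 * I.card : ℕ) : ℕ∞) := by
    push_cast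
    exact h1.trans (mul_le_mul_right h2 7)
  have h4 : ((vertices (hullOf F (range N))).encard : ℝ≥0∞) ≤ 7 * (I.card : ℝ≥0∞) := by
    have := ENat.toENNReal_le.2 h3
    simpa using this
  refine h4.trans ?_
  gcongr
  rw [Finset.card_eq_sum_ones, Nat.cast_sum, Finset.sum_filter]
  refine Finset.sum_le_sum fun i _ => ?_
  split_ifs with hi
  · obtain ⟨k, hk⟩ := hi
    calc ((1 : ℕ) : ℝ≥0∞) = (emptySector (density D) i k).indicator 1 N := by simp [hk]
      _ ≤ _ := Finset.single_le_sum (f := fun k => (emptySector (density D) i k).indicator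
          (1 : (Fin (m + 1) → ℂ) → ℝ≥0∞) N) (fun _ _ => zero_le) (Finset.mem_univ k)
  · exact zero_le

lemma expectation_le_lintegral {Ω : Type*} [MeasurableSpace Ω] {μ : Measure Ω} {f g : Ω → ℝ≥0∞}
    (hg : Measurable g) (h : ∀ᵐ ω ∂μ, f ω ≤ g ω) : expectation μ f ≤ ∫⁻ ω, g ω ∂μ :=
  iInf_le_of_le g (iInf_le_of_le hg (iInf_le _ h))

/-- A bound for the probability that a given test sector is empty bounds the expectation, as each
point has eight test sectors, each of which accounts for at most seven vertices. -/
lemma expectation_vertices_le {D : Set ℂ} (hD : IsDirectionSet D)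
    (hα : density D ≤ Real.pi / 2) (m : ℕ) {b : ℝ≥0∞}
    (hb : ∀ i k, uniformSample (m + 1) (emptySector (density D) i k) ≤ b) :
    expectation (uniformSample (m + 1))
      (fun N => ((vertices (hull D (range N))).encard : ℝ≥0∞)) ≤ 56 * (m + 1) * b := by
  have hmeas : ∀ i k, Measurable ((emptySector (density D) (m := m) i k).indicator
      (1 : (Fin (m + 1) → ℂ) → ℝ≥0∞)) := fun i k =>
    measurable_one.indicator (measurableSet_emptySector _ i k)
  have hmeas' : Measurable fun N : Fin (m + 1) → ℂ =>
      7 * ∑ i, ∑ k, (emptySector (density D) i k).indicator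
        (1 : (Fin (m + 1) → ℂ) → ℝ≥0∞) N := by
    refine Measurable.const_mul (Finset.measurable_fun_sum _ fun i _ =>
      Finset.measurable_fun_sum _ fun k _ => hmeas i k) _
  refine (expectation_le_lintegral hmeas' (ae_encard_vertices_le hD hα m)).trans ?_
  rw [lintegral_const_mul' _ _ (by norm_num),
    lintegral_finsetSum _ fun i _ => Finset.measurable_fun_sum _ fun k _ => hmeas i k]
  simp_rw [lintegral_finsetSum _ fun k _ => hmeas _ k,
    lintegral_indicator_one (measurableSet_emptySector _ _ _)]
  calc _ ≤ 7 * ∑ i : Fin (m + 1), ∑ k : Bool × Bool × Bool, b := by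
        gcongr with i _ k _; exact hb i k
    _ = _ := by
      simp only [Finset.sum_const, Finset.card_univ, Fintype.card_prod, Fintype.card_bool,
        Fintype.card_fin, nsmul_eq_mul]
      push_cast
      ring

end DirHull

theorem mainTheorem3 :
    ∃ K : ℝ, 0 < K ∧ ∀ D : Set ℂ, DirHull.IsDirectionSet D →
      DirHull.density D ≤ Real.pi / 2 → ∀ n : ℕ,
        DirHull.expectation (DirHull.uniformSample n)
            (fun N : Fin n → ℂ =>
              ((DirHull.vertices (DirHull.hull D (Set.range N))).encard : ℝ≥0∞))
          ≤ ENNReal.ofReal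
              (K * ((n : ℝ) ^ ((1 : ℝ) / 3) + Real.sqrt ((n : ℝ) * DirHull.density D))) := by
  obtain ⟨c, hc, hcs⟩ := DirHull.exists_le_volume_sector
  have hπ := Real.pi_pos
  have g1 := Real.Gamma_pos_of_pos (s := 5 / 3) (by norm_num)
  have g2 := Real.Gamma_pos_of_pos (s := 3 / 2) (by norm_num)
  set e := c / (4 * Real.pi) with he
  have hepos : 0 < e := by positivity
  set A := e ^ (-(2 / 3) : ℝ) * Real.Gamma (5 / 3) with hA
  set B := √(1 / e) * Real.Gamma (3 / 2) with hB
  have hApos : 0 < A := by positivity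
  have hBpos : 0 < B := by positivity
  refine ⟨56 + 224 * (A + B), by positivity, fun D hD hα n => ?_⟩
  have hα0 := DirHull.density_nonneg D
  obtain _ | m := n
  · -- the empty set has no exposed points
    refine (DirHull.expectation_le_lintegral (g := fun _ => 0) measurable_const ?_).trans (by simp)
    refine Filter.Eventually.of_forall fun N => ?_
    have h := (DirHull.isGapFamily_closure hD hα).encard_vertices_le (Set.finite_range N)
    rw [← DirHull.hull_eq_hullOf hD hα (Set.finite_range N)] at h
    have h0 : {p ∈ Set.range N | ∃ f ∈ closure (DirHull.dirPairs D),
        DirHull.Free (Set.range N) f p} = ∅ := by simp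
    rw [h0, Set.encard_empty, mul_zero] at h
    simpa using h
  obtain rfl | hm := m.eq_zero_or_pos
  · refine (DirHull.expectation_vertices_le hD hα 0 (b := 1) fun i k => prob_le_one).trans ?_
    rw [show (56 * ((0 : ℕ) + 1) * 1 : ℝ≥0∞) = ENNReal.ofReal 56 by simp]
    refine ENNReal.ofReal_le_ofReal ?_
    simp only [zero_add, Nat.cast_one, Real.one_rpow, one_mul]
    nlinarith [Real.sqrt_nonneg (DirHull.density D)]
  · refine (DirHull.expectation_vertices_le hD hα m
      (DirHull.uniformSample_emptySector_le_ofReal hc hcs hα0 hm)).trans ?_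
    have hm' : (0 : ℝ) < m := by exact_mod_cast hm
    have hm1 : (1 : ℝ) ≤ m := by exact_mod_cast hm
    rw [← he, show (56 * ((m : ℝ≥0∞) + 1)) = ENNReal.ofReal (56 * (m + 1)) by
      rw [ENNReal.ofReal_mul (by norm_num), ENNReal.ofReal_add hm'.le zero_le_one]; simp,
      ← ENNReal.ofReal_mul (by positivity)]
    refine ENNReal.ofReal_le_ofReal ?_
    push_cast
    set α := DirHull.density D
    have e1 : (m * e) ^ (-(2 / 3) : ℝ) * Real.Gamma (5 / 3) = (m : ℝ) ^ (-(2 / 3) : ℝ) * A := by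
      rw [Real.mul_rpow hm'.le hepos.le, hA]; ring
    have e2 : √(α / (m * e)) * Real.Gamma (3 / 2) = √(α / m) * B := by
      rw [hB, show α / (m * e) = α / m * (1 / e) by field_simp, Real.sqrt_mul (by positivity)]
      ring
    rw [e1, e2]
    have f1 : ((m : ℝ) + 1) * (m : ℝ) ^ (-(2 / 3) : ℝ) ≤ 2 * ((m : ℝ) + 1) ^ (1 / 3 : ℝ) := by
      calc ((m : ℝ) + 1) * (m : ℝ) ^ (-(2 / 3) : ℝ) ≤ (2 * m) * (m : ℝ) ^ (-(2 / 3) : ℝ) := by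
            gcongr; linarith
        _ = 2 * (m : ℝ) ^ (1 / 3 : ℝ) := by
            rw [mul_assoc, ← Real.rpow_one_add' hm'.le (by norm_num)]; norm_num
        _ ≤ _ := by gcongr; linarith
    have f2 : ((m : ℝ) + 1) * √(α / m) ≤ 2 * √((m + 1) * α) := by
      calc ((m : ℝ) + 1) * √(α / m) ≤ (2 * m) * √(α / m) := by gcongr; linarith
        _ = 2 * √(m * α) := by
            rw [show (m : ℝ) * α = m ^ 2 * (α / m) by field_simp, Real.sqrt_mul (by positivity),
              Real.sqrt_sq hm'.le]
            ring
        _ ≤ _ := by gcongr; linarith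
    have p1 : 0 ≤ ((m : ℝ) + 1) ^ (1 / 3 : ℝ) := by positivity
    have p2 := Real.sqrt_nonneg ((m + 1) * α)
    calc 56 * ((m : ℝ) + 1) * (2 * ((m : ℝ) ^ (-(2 / 3) : ℝ) * A + √(α / m) * B))
        = 112 * (((m : ℝ) + 1) * (m : ℝ) ^ (-(2 / 3) : ℝ)) * A
          + 112 * (((m : ℝ) + 1) * √(α / m)) * B := by ring
      _ ≤ 112 * (2 * ((m : ℝ) + 1) ^ (1 / 3 : ℝ)) * A + 112 * (2 * √((m + 1) * α)) * B := by gcongr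
      _ ≤ _ := by
        have := mul_nonneg hApos.le p2
        have := mul_nonneg hBpos.le p1
        nlinarith
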